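/- Let $n,m,p$ be positive integers such that either $n=m=1$ or $\gcd(n,m)\ge 2$. Let $\psi:\mathbb{N}\to\mathbb{R}_{>0}$, where $\mathbb{N}=\{1,2,\dots\}$, be an approximating function, i.e. a monotonically decreasing function with $\psi(q)\to 0$ as $q\to\infty$. For $(a,b)\in\mathbb{N}^2$ put $h_{a,b}=\max(a^n,b^m)$, and let $W_{n,m}^p(\psi)$ be the set of $(x_1,x_2)\in[0,1)^2$ for which the inequality $$|a^n x_1+b^m x_2-c^p|<\psi(h_{a,b})$$ holds for infinitely many triples $(a,b,c)\in\mathbb{N}^2\times\mathbb{Z}_{\ge 0}$. Then the two-dimensional Lebesgue measure of $W_{n,m}^p(\psi)$ is $$|W_{n,m}^p(\psi)|=\begin{cases}0,&\text{if }\displaystyle\sum_{(a,b)\in\mathbb{N}^2}\frac{\psi(h_{a,b})}{h_{a,b}^{1-1/p}}<\infty,\\[2mm] 1,&\text{if }\displaystyle\sum_{(a,b)\in\mathbb{N}^2}\frac{\psi(h_{a,b})}{h_{a,b}^{1-1/p}}=\infty.\end{cases}$$ -/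

import Mathlib

/-- An approximating function: a positive arithmetic function on the positive integers,
decreasing (in the weak sense) to zero. -/
structure IsApproximatingFunction (ψ : ℕ+ → ℝ) : Prop where
  pos : ∀ q, 0 < ψ q
  antitone : Antitone ψ
  tendsto_zero : Filter.Tendsto ψ Filter.atTop (nhds 0)

/-- The natural height `h_{a,b} = max (a ^ n) (b ^ m)` of a pair of positive integers. -/
def pairHeight (n m : ℕ) (a b : ℕ+) : ℕ+ := max (a ^ n) (b ^ m)

/-- The set of points `(x₁, x₂)` of `[0,1)²` for which the inequality
`|a ^ n x₁ + b ^ m x₂ - c ^ p| < ψ (h_{a,b})` holds for infinitely many triples `(a, b, c)`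
with `a, b` positive integers and `c` a non-negative integer. -/
def approxSet (n m p : ℕ) (ψ : ℕ+ → ℝ) : Set (ℝ × ℝ) :=
  {x | x ∈ Set.Ico (0 : ℝ) 1 ×ˢ Set.Ico (0 : ℝ) 1 ∧
    {t : ℕ+ × ℕ+ × ℕ |
      |(t.1 : ℝ) ^ n * x.1 + (t.2.1 : ℝ) ^ m * x.2 - (t.2.2 : ℝ) ^ p| <
        ψ (pairHeight n m t.1 t.2.1)}.Infinite}

/-- The general term `ψ (h_{a,b}) / h_{a,b} ^ (1 - 1 / p)` of the volume sum. -/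
noncomputable def volumeTerm (n m p : ℕ) (ψ : ℕ+ → ℝ) (ab : ℕ+ × ℕ+) : ℝ :=
  ψ (pairHeight n m ab.1 ab.2) / (pairHeight n m ab.1 ab.2 : ℝ) ^ (1 - 1 / (p : ℝ))

open MeasureTheory Set Filter Topology

/-! For fixed `(a, b)` the solutions form parallel strips `|a^n x₁ + b^m x₂ - c^p| < ψ(h)` of width
comparable to `ψ(h) / h`. About `h^(1/p)` values of `c` matter, so the strips cover area `≪ ψ(h) /
h^(1-1/p)`, and convergence of the sum gives measure zero by Borel–Cantelli.

For divergence, keep only coprime pairs for which `a^n` and `b^m` are both comparable to `H_k = 8^(k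
n m p)`, whose `p`-th root is `G_k = 8^(k n m)`. They are a positive proportion of the `N_k = 8^(k m
p) 8^(k n p)` pairs of the box. By monotonicity of `ψ` the volume sum is dominated by `∑ M_k` with
`M_k = ψ(H_k) G_k N_k / H_k`, so `∑ M_k` diverges too. After truncating `ψ(H_k)` so that `M_k ≤ 1`,
the Chung–Erdős inequality is applied inside squares of side `q` kept at distance `ε` from the axes.
Coprimality makes distinct pairs give non-parallel strips, and a shear bounds an overlap by an
independent term `q² T T'`, where `T = δ G / H`, plus an error `δ δ' G / |D|`, where `D = a^n b'^m -
a'^n b^m` (`volume_stripSet_inter_le`). If the sums of `1 / |D|` over two blocks are controlled with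
decay `2^(-(k'-k))`, the limsup set fills a proportion of each square that depends on `ε` but not on
`q` (`le_volume_real_blockLimsup_inter`), and Lebesgue density upgrades this to full measure.

The arithmetic lies in `exists_sum_inv_powDet_pairBlock_le`. If `n ∣ m`, with `m = n l`, then `D` is
a difference of `n`-th powers of `a b'^l` and `a' b^l`; this reduces to a linear form in `(a, a')`,
with only a logarithmic loss. The case `m ∣ n` is symmetric. If `p = 1` and `d = gcd(n, m) ≥ 2`,
then `D` is a nonzero difference of `d`-th powers, hence `D² ≫ H H'`. In every remaining case `1/n +
1/m + 1/p < 1` and the volume sum converges for every `ψ`, so there is nothing to prove. -/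

/-! ### Spacing of `p`-th powers and the measure of their neighbourhoods on the line. -/

/-- The open `δ`-neighbourhood of the set of perfect `p`-th powers of natural numbers. -/
def powNhd (p : ℕ) (δ : ℝ) : Set ℝ := {y | ∃ c : ℕ, |y - (c : ℝ) ^ p| < δ}

lemma powNhd_eq_iUnion (p : ℕ) (δ : ℝ) : powNhd p δ = ⋃ c : ℕ, Metric.ball ((c : ℝ) ^ p) δ := by
  ext y
  simp [powNhd, Real.dist_eq]

lemma isOpen_powNhd (p : ℕ) (δ : ℝ) : IsOpen (powNhd p δ) := by
  rw [powNhd_eq_iUnion]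
  exact isOpen_iUnion fun _ => Metric.isOpen_ball

lemma sub_mul_pow_le_pow_sub_pow {x y : ℝ} (hy : 0 ≤ y) (hxy : y ≤ x) {p : ℕ} (hp : 0 < p) :
    (x - y) * x ^ (p - 1) ≤ x ^ p - y ^ p := by
  obtain ⟨k, rfl⟩ : ∃ k, p = k + 1 := ⟨p - 1, by omega⟩
  have h : y ^ k ≤ x ^ k := pow_le_pow_left₀ hy hxy k
  have := mul_le_mul_of_nonneg_left h hy
  simp only [Nat.add_sub_cancel, pow_succ]
  nlinarith

lemma pow_sub_pow_le_mul_sub {x y : ℝ} (hy : 0 ≤ y) (hxy : y ≤ x) (p : ℕ) :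
    x ^ p - y ^ p ≤ p * x ^ (p - 1) * (x - y) := by
  have h := abs_pow_sub_pow_le x y p
  rw [abs_of_nonneg (sub_nonneg.2 (pow_le_pow_left₀ hy hxy p)), abs_of_nonneg (sub_nonneg.2 hxy),
    abs_of_nonneg (hy.trans hxy), abs_of_nonneg hy, max_eq_left hxy] at h
  linarith

/-- The number of `p`-th powers `c ^ p` in `[x, y]` is controlled by the spacing of `p`-th powers
near `x`. -/
lemma card_pow_mem_Icc_le {p : ℕ} (hp : 0 < p) {x y s g : ℝ} (hs : 0 ≤ s) (hsx : s ^ p ≤ x)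
    (hg : 0 < g) (hgs : g ≤ s ^ (p - 1)) (hxy : x ≤ y) (C : Finset ℕ)
    (hC : ∀ c ∈ C, x ≤ (c : ℝ) ^ p ∧ (c : ℝ) ^ p ≤ y) : (C.card : ℝ) ≤ 1 + (y - x) / g := by
  rcases C.eq_empty_or_nonempty with rfl | hne
  · have : 0 ≤ (y - x) / g := div_nonneg (by linarith) hg.le
    simp
    linarith
  set c₀ := C.min' hne
  have hc₀ := hC c₀ (C.min'_mem hne)
  have hsub : C ⊆ Finset.Icc c₀ (c₀ + ⌊(y - x) / g⌋₊) := by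
    intro c hc
    have h1 : c₀ ≤ c := C.min'_le c hc
    refine Finset.mem_Icc.2 ⟨h1, ?_⟩
    have h1' : (c₀ : ℝ) ≤ c := by exact_mod_cast h1
    have h2 := sub_mul_pow_le_pow_sub_pow (Nat.cast_nonneg c₀) h1' hp
    have h3 : s ≤ c := le_of_pow_le_pow_left₀ hp.ne' (Nat.cast_nonneg c) (hsx.trans (hC c hc).1)
    have h4 : g ≤ (c : ℝ) ^ (p - 1) := hgs.trans (pow_le_pow_left₀ hs h3 _)
    have h5 : ((c - c₀ : ℕ) : ℝ) ≤ (y - x) / g := by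
      rw [le_div_iff₀ hg, Nat.cast_sub h1]
      have := mul_le_mul_of_nonneg_left h4 (sub_nonneg.2 h1')
      linarith [(hC c hc).2]
    have := Nat.le_floor h5
    omega
  have h := Finset.card_le_card hsub
  rw [Nat.card_Icc] at h
  have h6 : (C.card : ℝ) ≤ 1 + (⌊(y - x) / g⌋₊ : ℝ) := by
    have : C.card ≤ 1 + ⌊(y - x) / g⌋₊ := by omega
    exact_mod_cast this
  have := Nat.floor_le (div_nonneg (sub_nonneg.2 hxy) hg.le)
  linarith

lemma finite_pow_le {p : ℕ} (hp : 0 < p) (y : ℝ) : {c : ℕ | (c : ℝ) ^ p ≤ y}.Finite := by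
  refine (Set.finite_Iic (⌈y⌉₊)).subset fun c hc => ?_
  have h1 : (c : ℝ) ≤ (c : ℝ) ^ p := by
    rcases Nat.eq_zero_or_pos c with rfl | h
    · simp [hp.ne']
    · exact le_self_pow₀ (by exact_mod_cast h) hp.ne'
  have : (c : ℝ) ≤ ⌈y⌉₊ := (h1.trans hc).trans (Nat.le_ceil y)
  exact_mod_cast this

/-- A union bound over the centres in `[u - δ, v + δ]`. The hypothesis on `s` forces every such
centre `c ^ p` to have `c ≥ s`, so consecutive centres are at least `g` apart; the summand `1`
covers intervals shorter than a gap. -/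
lemma volume_powNhd_inter_Icc_le {p : ℕ} (hp : 0 < p) {δ u v s g : ℝ} (hδ : 0 ≤ δ) (hs : 0 ≤ s)
    (hsx : s ^ p ≤ u - δ) (hg : 0 < g) (hgs : g ≤ s ^ (p - 1)) (huv : u ≤ v) :
    volume (powNhd p δ ∩ Icc u v) ≤ ENNReal.ofReal (2 * δ * (1 + (v - u + 2 * δ) / g)) := by
  classical
  have hfin : {c : ℕ | u - δ ≤ (c : ℝ) ^ p ∧ (c : ℝ) ^ p ≤ v + δ}.Finite :=
    (finite_pow_le hp (v + δ)).subset fun c hc => hc.2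
  obtain ⟨C, hC⟩ : ∃ C : Finset ℕ, ∀ c, c ∈ C ↔ u - δ ≤ (c : ℝ) ^ p ∧ (c : ℝ) ^ p ≤ v + δ :=
    ⟨hfin.toFinset, fun c => hfin.mem_toFinset⟩
  have hcard : (C.card : ℝ) ≤ 1 + (v - u + 2 * δ) / g := by
    have := card_pow_mem_Icc_le hp (x := u - δ) (y := v + δ) hs hsx hg hgs (by linarith) C
      (fun c hc => (hC c).1 hc)
    convert this using 3
    ring
  have hsub : powNhd p δ ∩ Icc u v ⊆ ⋃ c ∈ C, Metric.ball ((c : ℝ) ^ p) δ := by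
    rintro y ⟨⟨c, hc⟩, hy⟩
    have h := abs_lt.1 hc
    simp only [mem_iUnion]
    refine ⟨c, ?_, by simpa [Real.dist_eq] using hc⟩
    rw [hC]
    constructor <;> linarith [hy.1, hy.2]
  calc volume (powNhd p δ ∩ Icc u v) ≤ volume (⋃ c ∈ C, Metric.ball ((c : ℝ) ^ p) δ) :=
        measure_mono hsub
    _ ≤ ∑ c ∈ C, volume (Metric.ball ((c : ℝ) ^ p) δ) := measure_biUnion_finset_le _ _
    _ = ENNReal.ofReal (C.card * (2 * δ)) := by
        simp only [Real.volume_ball, Finset.sum_const, nsmul_eq_mul]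
        rw [ENNReal.ofReal_mul (Nat.cast_nonneg C.card), ENNReal.ofReal_natCast]
    _ ≤ _ := by
        apply ENNReal.ofReal_le_ofReal
        rw [mul_comm]
        exact mul_le_mul_of_nonneg_left hcard (by positivity)

lemma one_le_abs_pow_sub_pow {p : ℕ} (hp : 0 < p) {c d : ℕ} (h : c ≠ d) :
    1 ≤ |(c : ℝ) ^ p - (d : ℝ) ^ p| := by
  have h1 : ((c : ℤ) ^ p - (d : ℤ) ^ p) ≠ 0 := by
    rw [sub_ne_zero]
    exact_mod_cast fun h2 => h (Nat.pow_left_injective hp.ne' h2)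
  exact_mod_cast Int.one_le_abs h1

/-- Since `δ ≤ 1 / 2` and distinct `p`-th powers are distinct integers, the balls are disjoint and
their lengths add up. The mean value bound converts the length of the interval into a count of
admissible `c ≤ M`. -/
lemma le_volume_powNhd_inter_Icc {p : ℕ} (hp : 0 < p) {δ u v M : ℝ} (hδ : 0 ≤ δ) (hδ' : δ ≤ 1 / 2)
    (hu : 0 ≤ u) (huv : u + 2 * δ ≤ v) (hM : 0 < M) (hv : v ≤ M ^ p) :
    ENNReal.ofReal (2 * δ * ((v - u - 2 * δ) / (p * M ^ (p - 1)) - 1)) ≤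
      volume (powNhd p δ ∩ Icc u v) := by
  classical
  have hpR : (p : ℝ) ≠ 0 := by exact_mod_cast hp.ne'
  set r := (v - δ) ^ (1 / (p : ℝ))
  set s := (u + δ) ^ (1 / (p : ℝ))
  have hr : r ^ p = v - δ := by
    rw [← Real.rpow_natCast, ← Real.rpow_mul (by linarith), one_div_mul_cancel hpR, Real.rpow_one]
  have hs : s ^ p = u + δ := by
    rw [← Real.rpow_natCast, ← Real.rpow_mul (by linarith), one_div_mul_cancel hpR, Real.rpow_one]
  have hs0 : 0 ≤ s := Real.rpow_nonneg (by linarith) _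
  have hr0 : 0 ≤ r := Real.rpow_nonneg (by linarith) _
  have hsr : s ≤ r := Real.rpow_le_rpow (by linarith) (by linarith) (by positivity)
  have hrM : r ≤ M := le_of_pow_le_pow_left₀ hp.ne' hM.le (by rw [hr]; linarith)
  have h1 : (v - u - 2 * δ) / (p * M ^ (p - 1)) ≤ r - s := by
    rw [div_le_iff₀ (by positivity)]
    have h2 := pow_sub_pow_le_mul_sub hs0 hsr p
    rw [hr, hs] at h2
    have h3 : r ^ (p - 1) ≤ M ^ (p - 1) := pow_le_pow_left₀ hr0 hrM _
    have h4 : p * r ^ (p - 1) * (r - s) ≤ p * M ^ (p - 1) * (r - s) := by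
      have := sub_nonneg.2 hsr
      gcongr
    linarith
  -- The ends were moved inwards by `δ` before taking roots, so whole balls lie in `[u, v]`;
  -- rounding both roots costs the `- 1` in the statement.
  set C := Finset.Icc ⌈s⌉₊ ⌊r⌋₊
  have hcard : r - s - 1 ≤ C.card := by
    have h5 : ((⌊r⌋₊ + 1 : ℕ) : ℝ) ≤ ((C.card + ⌈s⌉₊ : ℕ) : ℝ) := by
      have : ⌊r⌋₊ + 1 ≤ C.card + ⌈s⌉₊ := by
        simp only [C, Nat.card_Icc]
        omega
      exact_mod_cast this
    have h6 := Nat.lt_floor_add_one r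
    have h7 := Nat.ceil_lt_add_one hs0
    push_cast at h5
    linarith
  have hsub : (⋃ c ∈ C, Metric.ball ((c : ℝ) ^ p) δ) ⊆ powNhd p δ ∩ Icc u v := by
    intro y hy
    simp only [mem_iUnion] at hy
    obtain ⟨c, hc, hy⟩ := hy
    rw [Metric.mem_ball, Real.dist_eq] at hy
    refine ⟨⟨c, hy⟩, ?_⟩
    have hc' := Finset.mem_Icc.1 hc
    have h8 : s ≤ c := Nat.ceil_le.1 hc'.1
    have h9 : (c : ℝ) ≤ r := (Nat.le_floor_iff hr0).1 hc'.2
    have h10 := pow_le_pow_left₀ hs0 h8 p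
    have h11 := pow_le_pow_left₀ (Nat.cast_nonneg c) h9 p
    rw [hs] at h10
    rw [hr] at h11
    have := abs_lt.1 hy
    constructor <;> linarith
  calc ENNReal.ofReal (2 * δ * ((v - u - 2 * δ) / (p * M ^ (p - 1)) - 1))
      ≤ ENNReal.ofReal (C.card * (2 * δ)) := by
        apply ENNReal.ofReal_le_ofReal
        rw [mul_comm (C.card : ℝ)]
        exact mul_le_mul_of_nonneg_left (by linarith) (by positivity)
    _ = ∑ c ∈ C, volume (Metric.ball ((c : ℝ) ^ p) δ) := by
        simp only [Real.volume_ball, Finset.sum_const, nsmul_eq_mul]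
        rw [ENNReal.ofReal_mul (Nat.cast_nonneg C.card), ENNReal.ofReal_natCast]
    _ = volume (⋃ c ∈ C, Metric.ball ((c : ℝ) ^ p) δ) := by
        symm
        refine measure_biUnion_finset ?_ fun _ _ => measurableSet_ball
        intro c _ d _ hcd
        apply Metric.ball_disjoint_ball
        rw [Real.dist_eq]
        linarith [one_le_abs_pow_sub_pow hp hcd]
    _ ≤ _ := measure_mono hsub

/-! ### Strips in the plane: areas and overlaps. -/

lemma volume_preimage_affine {a : ℝ} (ha : a ≠ 0) (b : ℝ) (S : Set ℝ) :
    volume ((fun x => a * x + b) ⁻¹' S) = ENNReal.ofReal |a⁻¹| * volume S := by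
  have : (fun x => a * x + b) ⁻¹' S = (a * ·) ⁻¹' ((· + b) ⁻¹' S) := rfl
  rw [this, Real.volume_preimage_mul_left ha, measure_preimage_add_right]

/-- The points of `Q` at which the linear form `A x₁ + B x₂` is within `δ` of a perfect
`p`-th power. -/
def stripSet (A B : ℝ) (p : ℕ) (δ : ℝ) (Q : Set (ℝ × ℝ)) : Set (ℝ × ℝ) :=
  {x | x ∈ Q ∧ A * x.1 + B * x.2 ∈ powNhd p δ}

lemma measurableSet_stripSet (A B : ℝ) (p : ℕ) (δ : ℝ) {Q : Set (ℝ × ℝ)} (hQ : MeasurableSet Q) :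
    MeasurableSet (stripSet A B p δ Q) := by
  have h : Continuous fun x : ℝ × ℝ => A * x.1 + B * x.2 := by fun_prop
  exact hQ.inter ((isOpen_powNhd p δ).preimage h).measurableSet

/-- Fubini: on each horizontal line through the square the linear form sweeps an interval of length
`A q`, to which the one-dimensional bound applies with one `M` for all lines. -/
lemma le_volume_stripSet {A B : ℝ} {p : ℕ} {δ s₁ s₂ q M : ℝ} (hp : 0 < p) (hA : 0 < A) (hB : 0 ≤ B)
    (hs₁ : 0 ≤ s₁) (hs₂ : 0 ≤ s₂) (hq : 0 ≤ q) (hδ : 0 ≤ δ) (hδ' : δ ≤ 1 / 2)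
    (hδq : 2 * δ ≤ A * q) (hM : 0 < M) (hbd : A * (s₁ + q) + B * (s₂ + q) ≤ M ^ p) :
    ENNReal.ofReal (q * (A⁻¹ * (2 * δ * ((A * q - 2 * δ) / (p * M ^ (p - 1)) - 1)))) ≤
      volume (stripSet A B p δ (Icc s₁ (s₁ + q) ×ˢ Icc s₂ (s₂ + q))) := by
  have hmeas := measurableSet_stripSet A B p δ
    ((measurableSet_Icc (a := s₁) (b := s₁ + q)).prod (measurableSet_Icc (a := s₂) (b := s₂ + q)))
  rw [Measure.volume_eq_prod, Measure.prod_apply_symm hmeas]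
  have key : ∀ y ∈ Icc s₂ (s₂ + q),
      ENNReal.ofReal (A⁻¹ * (2 * δ * ((A * q - 2 * δ) / (p * M ^ (p - 1)) - 1))) ≤
      volume ((fun x => (x, y)) ⁻¹' stripSet A B p δ (Icc s₁ (s₁ + q) ×ˢ Icc s₂ (s₂ + q))) := by
    intro y hy
    have hBy : 0 ≤ B * y := mul_nonneg hB (hs₂.trans hy.1)
    have hBy' : B * y ≤ B * (s₂ + q) := mul_le_mul_of_nonneg_left hy.2 hB
    have hAs : 0 ≤ A * s₁ := mul_nonneg hA.le hs₁
    have h1 := le_volume_powNhd_inter_Icc hp hδ hδ' (u := A * s₁ + B * y)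
      (v := A * (s₁ + q) + B * y) (by positivity) (by linarith) hM (by linarith)
    have hset : (fun x => A * x + B * y) ⁻¹'
        (powNhd p δ ∩ Icc (A * s₁ + B * y) (A * (s₁ + q) + B * y)) ⊆
        (fun x => (x, y)) ⁻¹' stripSet A B p δ (Icc s₁ (s₁ + q) ×ˢ Icc s₂ (s₂ + q)) := by
      rintro x ⟨hx1, hx2⟩
      refine ⟨⟨⟨?_, ?_⟩, hy⟩, hx1⟩
      · exact le_of_mul_le_mul_left (by linarith [hx2.1]) hA
      · exact le_of_mul_le_mul_left (by linarith [hx2.2]) hA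
    refine le_trans ?_ (measure_mono hset)
    rw [volume_preimage_affine hA.ne', abs_of_pos (inv_pos.2 hA),
      ENNReal.ofReal_mul (inv_pos.2 hA).le]
    gcongr
    refine le_trans (le_of_eq ?_) h1
    congr 4
    ring
  calc _ = ∫⁻ _ in Icc s₂ (s₂ + q),
        ENNReal.ofReal (A⁻¹ * (2 * δ * ((A * q - 2 * δ) / (p * M ^ (p - 1)) - 1))) := by
        rw [setLIntegral_const, Real.volume_Icc, add_sub_cancel_left, mul_comm q,
          ENNReal.ofReal_mul' hq]
    _ ≤ ∫⁻ y in Icc s₂ (s₂ + q), _ := setLIntegral_mono' measurableSet_Icc key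
    _ ≤ _ := setLIntegral_le_lintegral _ _

lemma volume_strip_inter_square_le_left {A B : ℝ} (hA : 0 < A) (z δ : ℝ) :
    volume {x : ℝ × ℝ | x ∈ Icc (0 : ℝ) 1 ×ˢ Icc (0 : ℝ) 1 ∧ |A * x.1 + B * x.2 - z| < δ} ≤
      ENNReal.ofReal (2 * δ / A) := by
  have hmeas : MeasurableSet
      {x : ℝ × ℝ | x ∈ Icc (0 : ℝ) 1 ×ˢ Icc (0 : ℝ) 1 ∧ |A * x.1 + B * x.2 - z| < δ} := by
    have h : MeasurableSet {x : ℝ × ℝ | |A * x.1 + B * x.2 - z| < δ} :=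
      (isOpen_lt (by fun_prop) continuous_const).measurableSet
    exact (measurableSet_Icc.prod measurableSet_Icc).inter h
  rw [Measure.volume_eq_prod, Measure.prod_apply_symm hmeas]
  calc _ ≤ ∫⁻ y, (Icc (0 : ℝ) 1).indicator (fun _ => ENNReal.ofReal (2 * δ / A)) y := by
        refine lintegral_mono fun y => ?_
        by_cases hy : y ∈ Icc (0 : ℝ) 1
        · rw [indicator_of_mem hy]
          refine (measure_mono (t := (fun x => A * x + B * y) ⁻¹' Metric.ball z δ) ?_).trans ?_
          · rintro x ⟨-, hx⟩
            simpa [Real.dist_eq] using hx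
          · rw [volume_preimage_affine hA.ne', abs_of_pos (inv_pos.2 hA), Real.volume_ball,
              ← ENNReal.ofReal_mul (inv_pos.2 hA).le]
            apply le_of_eq
            congr 1
            ring
        · rw [indicator_of_notMem hy]
          exact (measure_mono (t := ∅) fun x hx => (hy hx.1.2).elim).trans (by simp)
    _ = _ := by
        rw [lintegral_indicator_const measurableSet_Icc]
        simp

lemma volume_strip_inter_square_le_right {A B : ℝ} (hB : 0 < B) (z δ : ℝ) :
    volume {x : ℝ × ℝ | x ∈ Icc (0 : ℝ) 1 ×ˢ Icc (0 : ℝ) 1 ∧ |A * x.1 + B * x.2 - z| < δ} ≤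
      ENNReal.ofReal (2 * δ / B) := by
  have h := volume_strip_inter_square_le_left (A := B) (B := A) hB z δ
  have hswap : MeasurePreserving (Prod.swap : ℝ × ℝ → ℝ × ℝ) volume volume :=
    Measure.measurePreserving_swap
  rw [← hswap.measure_preimage_emb MeasurableEquiv.prodComm.measurableEmbedding] at h
  refine (measure_mono fun x hx => ?_).trans h
  refine ⟨⟨hx.1.2, hx.1.1⟩, ?_⟩
  have := hx.2
  simpa [add_comm] using this

/-- Only `c < N` can meet the unit square, and each single strip is sliced along the coordinate with
the larger coefficient, whence the `max`. -/
lemma volume_strips_inter_square_le {A B : ℝ} {p N : ℕ} {δ : ℝ} (hA : 0 < A)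
    (hB : 0 < B) (hN : A + B + δ ≤ (N : ℝ) ^ p) :
    volume (stripSet A B p δ (Icc (0 : ℝ) 1 ×ˢ Icc (0 : ℝ) 1)) ≤
      ENNReal.ofReal (N * (2 * δ / max A B)) := by
  have hsub : stripSet A B p δ (Icc (0 : ℝ) 1 ×ˢ Icc (0 : ℝ) 1) ⊆ ⋃ c ∈ Finset.range N,
      {x : ℝ × ℝ | x ∈ Icc (0 : ℝ) 1 ×ˢ Icc (0 : ℝ) 1 ∧
        |A * x.1 + B * x.2 - (c : ℝ) ^ p| < δ} := by
    rintro x ⟨hx, c, hc⟩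
    simp only [mem_iUnion, Finset.mem_range]
    refine ⟨c, ?_, hx, hc⟩
    have h1 := (abs_lt.1 hc).1
    have h2 : A * x.1 ≤ A := mul_le_of_le_one_right hA.le hx.1.2
    have h3 : B * x.2 ≤ B := mul_le_of_le_one_right hB.le hx.2.2
    have h4 : (c : ℝ) ^ p < (N : ℝ) ^ p := by linarith
    exact_mod_cast lt_of_pow_lt_pow_left₀ p (Nat.cast_nonneg N) h4
  calc _ ≤ ∑ c ∈ Finset.range N, volume {x : ℝ × ℝ | x ∈ Icc (0 : ℝ) 1 ×ˢ Icc (0 : ℝ) 1 ∧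
        |A * x.1 + B * x.2 - (c : ℝ) ^ p| < δ} :=
        (measure_mono hsub).trans (measure_biUnion_finset_le _ _)
    _ ≤ ∑ c ∈ Finset.range N, ENNReal.ofReal (2 * δ / max A B) := by
        refine Finset.sum_le_sum fun c _ => ?_
        rcases max_choice A B with h | h <;> rw [h]
        · exact volume_strip_inter_square_le_left hA _ _
        · exact volume_strip_inter_square_le_right hB _ _
    _ = _ := by
        rw [Finset.sum_const, Finset.card_range, nsmul_eq_mul,
          ENNReal.ofReal_mul (Nat.cast_nonneg N), ENNReal.ofReal_natCast]

lemma volume_preimage_shear {A : ℝ} (hA : 0 < A) (B : ℝ) (F : Set (ℝ × ℝ)) :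
    volume ((fun x : ℝ × ℝ => (A * x.1 + B * x.2, x.2)) ⁻¹' F) =
      ENNReal.ofReal A⁻¹ * volume F := by
  set f : ℝ × ℝ →ₗ[ℝ] ℝ × ℝ := Matrix.toLin (Module.Basis.finTwoProd ℝ) (Module.Basis.finTwoProd ℝ)
    !![A, B; 0, 1] with hf
  have hdet : LinearMap.det f = A := by
    rw [hf, LinearMap.det_toLin]
    simp
  have hfun : (fun x : ℝ × ℝ => (A * x.1 + B * x.2, x.2)) = f := by
    ext x <;> simp [hf, Matrix.toLin_finTwoProd_apply]
  rw [hfun, Measure.addHaar_preimage_linearMap _ (by rw [hdet]; exact hA.ne'), hdet,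
    abs_of_pos (inv_pos.2 hA)]

/-- The overlap of two families of strips in non-parallel directions inside a square. -/
lemma volume_stripSet_inter_le {A B A' B' D : ℝ} {p : ℕ} {δ δ' s₁ s₂ q s s' g g' : ℝ} (hp : 0 < p)
    (hA : 0 < A) (hB : 0 < B) (hA' : 0 < A') (hB' : 0 < B') (hD : D = A * B' - A' * B)
    (hD0 : D ≠ 0) (hq : 0 ≤ q) (hδ : 0 ≤ δ) (hδ' : 0 ≤ δ')
    (hs : 0 ≤ s) (hsu : s ^ p ≤ A * s₁ + B * s₂ - δ) (hg : 0 < g) (hgs : g ≤ s ^ (p - 1))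
    (hs' : 0 ≤ s') (hsu' : s' ^ p ≤ A' * s₁ + B' * s₂ - δ') (hg' : 0 < g')
    (hgs' : g' ≤ s' ^ (p - 1)) :
    volume (stripSet A B p δ (Icc s₁ (s₁ + q) ×ˢ Icc s₂ (s₂ + q)) ∩
        stripSet A' B' p δ' (Icc s₁ (s₁ + q) ×ˢ Icc s₂ (s₂ + q))) ≤
      ENNReal.ofReal (A⁻¹ * ((A / |D| * (2 * δ' * (1 + (|D| * q / A + 2 * δ') / g'))) *
        (2 * δ * (1 + ((A + B) * q + 2 * δ) / g)))) := by
  set u := A * s₁ + B * s₂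
  set v := u + (A + B) * q
  set u' := A' * s₁ + B' * s₂
  -- In the sheared coordinates `(A x₁ + B x₂, x₂)` the first family constrains only the first
  -- coordinate, and the second form becomes `(D / A) x₂` plus a multiple of that coordinate, so a
  -- slice sees the angle only through `D / A`.
  set F : Set (ℝ × ℝ) := {z | z.1 ∈ powNhd p δ ∩ Icc u v ∧ z.2 ∈ Icc s₂ (s₂ + q) ∧
    (D / A) * z.2 + (A' / A) * z.1 ∈ powNhd p δ' ∩ Ici u'} with hF
  have hDpos : 0 < |D| := abs_pos.2 hD0
  have hsub : stripSet A B p δ (Icc s₁ (s₁ + q) ×ˢ Icc s₂ (s₂ + q)) ∩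
      stripSet A' B' p δ' (Icc s₁ (s₁ + q) ×ˢ Icc s₂ (s₂ + q)) ⊆
      (fun x : ℝ × ℝ => (A * x.1 + B * x.2, x.2)) ⁻¹' F := by
    rintro x ⟨⟨⟨h1, h2⟩, h3⟩, ⟨-, h4⟩⟩
    have e : (D / A) * x.2 + (A' / A) * (A * x.1 + B * x.2) = A' * x.1 + B' * x.2 := by
      rw [hD]
      field_simp
      ring
    have b1 := mul_le_mul_of_nonneg_left h1.1 hA.le
    have b2 := mul_le_mul_of_nonneg_left h2.1 hB.le
    have b3 := mul_le_mul_of_nonneg_left h1.2 hA.le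
    have b4 := mul_le_mul_of_nonneg_left h2.2 hB.le
    have b5 := mul_le_mul_of_nonneg_left h1.1 hA'.le
    have b6 := mul_le_mul_of_nonneg_left h2.1 hB'.le
    refine ⟨⟨h3, ?_, ?_⟩, h2, ?_⟩
    · simp only [u]; linarith
    · simp only [v, u]; linarith
    · simp only [e]
      refine ⟨h4, ?_⟩
      simp only [mem_Ici, u']
      linarith
  have hFmeas : MeasurableSet F := by
    have c1 : Continuous fun z : ℝ × ℝ => (D / A) * z.2 + (A' / A) * z.1 := by fun_prop
    have m1 := ((isOpen_powNhd p δ).measurableSet.inter (measurableSet_Icc (a := u) (b := v)))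
    have m2 := ((isOpen_powNhd p δ').measurableSet.inter (measurableSet_Ici (a := u')))
    exact (measurable_fst m1).inter ((measurable_snd measurableSet_Icc).inter (c1.measurable m2))
  have hvF : volume F ≤
      ENNReal.ofReal (A / |D| * (2 * δ' * (1 + (|D| * q / A + 2 * δ') / g'))) *
      volume (powNhd p δ ∩ Icc u v) := by
    rw [Measure.volume_eq_prod, Measure.prod_apply hFmeas]
    calc _ ≤ ∫⁻ y, (powNhd p δ ∩ Icc u v).indicator (fun _ =>
          ENNReal.ofReal (A / |D| * (2 * δ' * (1 + (|D| * q / A + 2 * δ') / g')))) y := by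
          refine lintegral_mono fun y => ?_
          by_cases hy : y ∈ powNhd p δ ∩ Icc u v
          · rw [indicator_of_mem hy]
            -- Smallest value of the second form on this slice when `x₂` ranges over the side of the
            -- square. It may fall below `u'`, where gaps between `p`-th powers are not controlled,
            -- so the interval is cut at `max lo u'`.
            set lo := min ((D / A) * s₂) ((D / A) * (s₂ + q)) + (A' / A) * y with hlo
            have hsl : Prod.mk y ⁻¹' F ⊆ (fun w => (D / A) * w + (A' / A) * y) ⁻¹'
                (powNhd p δ' ∩ Icc (max lo u') (lo + |D| * q / A)) := by
              rintro w ⟨-, hw, hw2, hw3⟩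
              refine ⟨hw2, max_le ?_ hw3, ?_⟩
              · simp only [hlo]
                gcongr
                rcases le_total 0 (D / A) with h | h
                · exact (min_le_left _ _).trans (mul_le_mul_of_nonneg_left hw.1 h)
                · exact (min_le_right _ _).trans (mul_le_mul_of_nonpos_left hw.2 h)
              · have e1 : |D| * q / A = |D / A| * q := by
                  rw [abs_div, abs_of_pos hA]
                  ring
                simp only [hlo, e1]
                rcases le_total 0 (D / A) with h | h
                · rw [min_eq_left (mul_le_mul_of_nonneg_left (by linarith) h), abs_of_nonneg h]
                  have := mul_le_mul_of_nonneg_left hw.2 h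
                  linarith
                · rw [min_eq_right (mul_le_mul_of_nonpos_left (by linarith) h), abs_of_nonpos h]
                  have := mul_le_mul_of_nonpos_left hw.1 h
                  linarith
            refine (measure_mono hsl).trans ?_
            rw [volume_preimage_affine (div_ne_zero hD0 hA.ne'), inv_div, abs_div, abs_of_pos hA,
              ENNReal.ofReal_mul (by positivity)]
            gcongr
            rcases le_or_gt (max lo u') (lo + |D| * q / A) with hle | hlt
            · refine (volume_powNhd_inter_Icc_le hp hδ' hs'
                (hsu'.trans (sub_le_sub_right (le_max_right lo u') δ')) hg' hgs' hle).trans ?_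
              apply ENNReal.ofReal_le_ofReal
              gcongr
              linarith [le_max_left lo u']
            · rw [Icc_eq_empty (not_le.2 hlt)]
              simp
          · rw [indicator_of_notMem hy]
            exact (measure_mono (t := ∅) fun x hx => (hy hx.1).elim).trans (by simp)
      _ = _ := lintegral_indicator_const
          ((isOpen_powNhd p δ).measurableSet.inter measurableSet_Icc) _
  have huv : u ≤ v := by
    have : 0 ≤ (A + B) * q := by positivity
    simp only [v]
    linarith
  have hY := volume_powNhd_inter_Icc_le hp hδ hs hsu hg hgs huv
  have e2 : v - u = (A + B) * q := by simp only [v]; ring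
  rw [e2] at hY
  refine (measure_mono hsub).trans ?_
  rw [volume_preimage_shear hA, ENNReal.ofReal_mul (inv_pos.2 hA).le,
    ENNReal.ofReal_mul (by positivity)]
  gcongr
  exact hvF.trans (by gcongr)

/-! ### Counting coprime pairs in a box. -/

/-- Coprime pairs `(a, b)` in the box `(α / 8, α] × (β / 8, β]`. -/
def coprimeBlock (α β : ℕ) : Finset (ℕ × ℕ) :=
  (Finset.Ioc 0 α ×ˢ Finset.Ioc 0 β).filter
    fun v => α < 8 * v.1 ∧ β < 8 * v.2 ∧ Nat.Coprime v.1 v.2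

lemma mem_coprimeBlock {α β : ℕ} {v : ℕ × ℕ} : v ∈ coprimeBlock α β ↔
    ((0 < v.1 ∧ v.1 ≤ α) ∧ (0 < v.2 ∧ v.2 ≤ β)) ∧ α < 8 * v.1 ∧ β < 8 * v.2 ∧
      Nat.Coprime v.1 v.2 := by
  simp [coprimeBlock]

lemma card_coprimeBlock_le (α β : ℕ) : (coprimeBlock α β).card ≤ α * β := by
  refine (Finset.card_filter_le _ _).trans ?_
  simp

/-- Exact terms for `r = 2, 3`, then telescoping: `25 / 36 = 1 / 4 + 1 / 9 + 1 / 3`. -/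
lemma sum_inv_sq_Icc_two_le (N : ℕ) (hN : 3 ≤ N) :
    ∑ r ∈ Finset.Icc 2 N, ((r : ℝ) ^ 2)⁻¹ ≤ 25 / 36 - 1 / N := by
  induction N, hN using Nat.le_induction with
  | base =>
    have : Finset.Icc 2 3 = {2, 3} := by decide
    rw [this]
    norm_num
  | succ N hN ih =>
    rw [Finset.sum_Icc_succ_top (by omega)]
    have hN' : (0 : ℝ) < N := by exact_mod_cast (by omega : 0 < N)
    have h : (((N + 1 : ℕ) : ℝ) ^ 2)⁻¹ ≤ 1 / N - 1 / ((N + 1 : ℕ) : ℝ) := by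
      push_cast
      rw [div_sub_div _ _ hN'.ne' (by positivity), inv_eq_one_div,
        div_le_div_iff₀ (by positivity) (by positivity)]
      nlinarith
    linarith

/-- Discard the two thin margins and the pairs sharing a divisor `r ≥ 2`; what is left is at least
`1 - 1/8 - 1/8 - 25/36 = 1/18` of the box. -/
lemma le_card_coprimeBlock (α β : ℕ) : (α * β : ℝ) / 18 ≤ (coprimeBlock α β).card := by
  set U := Finset.Ioc 0 α ×ˢ Finset.Ioc 0 β
  set S₁ := Finset.Ioc 0 (α / 8) ×ˢ Finset.Ioc 0 β
  set S₂ := Finset.Ioc 0 α ×ˢ Finset.Ioc 0 (β / 8)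
  -- Common divisors are at most `α`; the extra `3` only meets the hypothesis of
  -- `sum_inv_sq_Icc_two_le`.
  set S₃ := (Finset.Icc 2 (α + 3)).biUnion fun r =>
    (Finset.Ioc 0 α).filter (r ∣ ·) ×ˢ (Finset.Ioc 0 β).filter (r ∣ ·)
  have hsub : U ⊆ coprimeBlock α β ∪ (S₁ ∪ (S₂ ∪ S₃)) := by
    rintro ⟨a, b⟩ hv
    simp only [U, S₁, S₂, S₃, Finset.mem_union, mem_coprimeBlock, Finset.mem_product,
      Finset.mem_Ioc, Finset.mem_biUnion, Finset.mem_filter, Finset.mem_Icc] at hv ⊢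
    by_cases h1 : 8 * a ≤ α
    · right; left; omega
    by_cases h2 : 8 * b ≤ β
    · right; right; left; omega
    by_cases h3 : Nat.Coprime a b
    · left
      exact ⟨hv, by omega, by omega, h3⟩
    right; right; right
    have hg : 0 < Nat.gcd a b := Nat.gcd_pos_of_pos_left _ hv.1.1
    have hg' : Nat.gcd a b ≠ 1 := h3
    have hg'' : Nat.gcd a b ≤ a := Nat.gcd_le_left _ hv.1.1
    exact ⟨Nat.gcd a b, ⟨by omega, by omega⟩, ⟨hv.1, Nat.gcd_dvd_left _ _⟩,
      ⟨hv.2, Nat.gcd_dvd_right _ _⟩⟩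
  have hU : U.card = α * β := by simp [U]
  have h1 : (S₁.card : ℝ) ≤ α * β / 8 := by
    have : S₁.card = α / 8 * β := by simp [S₁]
    rw [this]
    push_cast
    have h := Nat.cast_div_le (α := ℝ) (m := α) (n := 8)
    push_cast at h
    have := mul_le_mul_of_nonneg_right h (Nat.cast_nonneg (α := ℝ) β)
    linarith
  have h2 : (S₂.card : ℝ) ≤ α * β / 8 := by
    have : S₂.card = α * (β / 8) := by simp [S₂]
    rw [this]
    push_cast
    have h := Nat.cast_div_le (α := ℝ) (m := β) (n := 8)
    push_cast at h
    have := mul_le_mul_of_nonneg_left h (Nat.cast_nonneg (α := ℝ) α)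
    linarith
  have h3 : (S₃.card : ℝ) ≤ α * β * (25 / 36) := by
    have h4 : S₃.card ≤ ∑ r ∈ Finset.Icc 2 (α + 3), (α / r) * (β / r) := by
      refine Finset.card_biUnion_le.trans (Finset.sum_le_sum fun r _ => ?_)
      rw [Finset.card_product, Nat.Ioc_filter_dvd_card_eq_div, Nat.Ioc_filter_dvd_card_eq_div]
    calc (S₃.card : ℝ) ≤ ∑ r ∈ Finset.Icc 2 (α + 3), (α * β : ℝ) * ((r : ℝ) ^ 2)⁻¹ := by
          refine (Nat.cast_le.2 h4).trans ?_
          push_cast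
          refine Finset.sum_le_sum fun r _ => ?_
          calc ((α / r : ℕ) : ℝ) * ((β / r : ℕ) : ℝ) ≤ (α / r : ℝ) * (β / r : ℝ) :=
                mul_le_mul Nat.cast_div_le Nat.cast_div_le (by positivity) (by positivity)
            _ = _ := by ring
      _ ≤ α * β * (25 / 36) := by
          rw [← Finset.mul_sum]
          refine mul_le_mul_of_nonneg_left ?_ (by positivity)
          refine (sum_inv_sq_Icc_two_le (α + 3) (by omega)).trans ?_
          have : (0 : ℝ) ≤ 1 / ((α + 3 : ℕ) : ℝ) := by positivity
          linarith
  have h4 : α * β ≤ (coprimeBlock α β).card + (S₁.card + (S₂.card + S₃.card)) := by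
    rw [← hU]
    refine (Finset.card_le_card hsub).trans ((Finset.card_union_le _ _).trans ?_)
    gcongr
    refine (Finset.card_union_le _ _).trans ?_
    gcongr
    exact Finset.card_union_le _ _
  have h5 : (α * β : ℝ) ≤ (coprimeBlock α β).card + (S₁.card + (S₂.card + S₃.card)) := by
    exact_mod_cast h4
  linarith

/-! ### Lower bounds for determinants and sums of their reciprocals. -/

/-- The determinant of the vectors `(a ^ n, b ^ m)` and `(a' ^ n, b' ^ m)`. -/
def powDet (n m : ℕ) (x y : ℕ × ℕ) : ℤ :=
  (x.1 : ℤ) ^ n * (y.2 : ℤ) ^ m - (y.1 : ℤ) ^ n * (x.2 : ℤ) ^ m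

/-- Proportionality of the two vectors, with both pairs coprime, makes the first entries divide each
other. This is why the blocks keep only coprime pairs: distinct pairs never give parallel strips. -/
lemma powDet_ne_zero {n m : ℕ} (hn : 0 < n) (hm : 0 < m) {x y : ℕ × ℕ} (hx : Nat.Coprime x.1 x.2)
    (hy : Nat.Coprime y.1 y.2) (h1 : 0 < x.1) (hxy : x ≠ y) : powDet n m x y ≠ 0 := by
  intro h
  have e : x.1 ^ n * y.2 ^ m = y.1 ^ n * x.2 ^ m := by
    have := sub_eq_zero.1 h
    exact_mod_cast this
  have d1 : x.1 ^ n ∣ y.1 ^ n :=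
    (Nat.Coprime.pow n m hx).dvd_of_dvd_mul_right (Dvd.intro _ e)
  have d2 : y.1 ^ n ∣ x.1 ^ n :=
    (Nat.Coprime.pow n m hy).dvd_of_dvd_mul_right (Dvd.intro _ e.symm)
  have e1 : x.1 ^ n = y.1 ^ n := Nat.dvd_antisymm d1 d2
  have e2 : x.1 = y.1 := Nat.pow_left_injective hn.ne' e1
  rw [← e1] at e
  have e3 := Nat.eq_of_mul_eq_mul_left (pow_pos h1 n) e
  exact hxy (Prod.ext e2 (Nat.pow_left_injective hm.ne' e3).symm)

/-- Each absolute value `i` is attained at most `2 K` times, for `i` and `-i`, so the sum is at most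
`2 K` times a harmonic sum. -/
lemma sum_inv_natAbs_le {ι : Type*} (S : Finset ι) (f : ι → ℤ) (J K : ℕ) (h0 : ∀ x ∈ S, f x ≠ 0)
    (hJ : ∀ x ∈ S, (f x).natAbs ≤ J) (hK : ∀ j : ℤ, (S.filter (f · = j)).card ≤ K) :
    ∑ x ∈ S, ((f x).natAbs : ℝ)⁻¹ ≤ 2 * K * (1 + Real.log J) := by
  classical
  have hmaps : ∀ x ∈ S, (f x).natAbs ∈ Finset.Icc 1 J := fun x hx =>
    Finset.mem_Icc.2 ⟨Int.natAbs_pos.2 (h0 x hx), hJ x hx⟩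
  rw [← Finset.sum_fiberwise_of_maps_to hmaps]
  calc _ ≤ ∑ i ∈ Finset.Icc 1 J, (2 * K : ℝ) * (i : ℝ)⁻¹ := by
        refine Finset.sum_le_sum fun i _ => ?_
        have h1 : ∀ x ∈ S.filter (fun x => (f x).natAbs = i), ((f x).natAbs : ℝ)⁻¹ = (i : ℝ)⁻¹ :=
          fun x hx => by rw [(Finset.mem_filter.1 hx).2]
        rw [Finset.sum_congr rfl h1, Finset.sum_const, nsmul_eq_mul]
        refine mul_le_mul_of_nonneg_right ?_ (by positivity)
        have h2 : S.filter (fun x => (f x).natAbs = i) ⊆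
            S.filter (f · = (i : ℤ)) ∪ S.filter (f · = -(i : ℤ)) := by
          intro x hx
          simp only [Finset.mem_filter, Finset.mem_union] at hx ⊢
          rcases Int.natAbs_eq_iff.1 hx.2 with h | h
          · exact Or.inl ⟨hx.1, h⟩
          · exact Or.inr ⟨hx.1, h⟩
        have h3 := (Finset.card_le_card h2).trans (Finset.card_union_le _ _)
        have h4 : (S.filter (fun x => (f x).natAbs = i)).card ≤ 2 * K := by
          linarith [hK i, hK (-i)]
        exact_mod_cast h4
    _ ≤ _ := by
        rw [← Finset.mul_sum]
        refine mul_le_mul_of_nonneg_left ?_ (by positivity)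
        have := harmonic_le_one_add_log J
        rw [harmonic_eq_sum_Icc] at this
        push_cast at this
        exact this

/-- On a level set the first coordinate is fixed modulo `v`, so its quotient by `v` determines it,
and then the second coordinate as well. -/
lemma card_linear_fiber_le {α α' u v : ℕ} (huv : Nat.Coprime u v) (hv : 0 < v)
    (S : Finset (ℕ × ℕ)) (hS : S ⊆ Finset.Ioc 0 α ×ˢ Finset.Ioc 0 α') (j : ℤ) :
    (S.filter (fun x => (x.1 : ℤ) * u - x.2 * v = j)).card ≤ α / v + 1 := by
  rw [← Finset.card_range (α / v + 1)]
  refine Finset.card_le_card_of_injOn (fun x => x.1 / v) ?_ ?_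
  · intro x hx
    have hx' := Finset.mem_product.1 (hS (Finset.mem_filter.1 hx).1)
    have := Nat.div_le_div_right (c := v) (Finset.mem_Ioc.1 hx'.1).2
    simp only [Finset.coe_range, Set.mem_Iio]
    omega
  · intro x hx y hy hxy
    have hx' := (Finset.mem_filter.1 hx).2
    have hy' := (Finset.mem_filter.1 hy).2
    have e : ((x.1 : ℤ) - y.1) * u = ((x.2 : ℤ) - y.2) * v := by linear_combination hx' - hy'
    have hd : (v : ℤ) ∣ (x.1 : ℤ) - y.1 := by
      have h1 : (v : ℤ) ∣ ((x.1 : ℤ) - y.1) * u := ⟨_, e.trans (mul_comm _ _)⟩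
      exact IsCoprime.dvd_of_dvd_mul_right (Nat.isCoprime_iff_coprime.2 huv.symm) h1
    have hm : y.1 % v = x.1 % v := (Nat.modEq_iff_dvd).2 hd
    have e1 : x.1 = y.1 := by
      rw [← Nat.div_add_mod x.1 v, ← Nat.div_add_mod y.1 v, hm]
      simp only at hxy
      rw [hxy]
    rw [e1, sub_self, zero_mul] at e
    have e2 : (x.2 : ℤ) - y.2 = 0 := by
      rcases mul_eq_zero.1 e.symm with h | h
      · exact h
      · exact absurd h (by exact_mod_cast hv.ne')
    exact Prod.ext e1 (by omega)

/-- Dividing by `g = gcd(u, v)` reduces to coprime coefficients. Level sets may grow by a factor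
`g`, but every value of the form carries the same factor, so `g` cancels. Zeros of the form
contribute nothing because `0⁻¹ = 0`. -/
lemma sum_inv_linear_le {α α' u v : ℕ} (hu : 0 < u) (hv : 0 < v) (S : Finset (ℕ × ℕ))
    (hS : S ⊆ Finset.Ioc 0 α ×ˢ Finset.Ioc 0 α') :
    ∑ x ∈ S, |((x.1 * u : ℝ) - x.2 * v)|⁻¹ ≤
      2 * (α / v + 1) * (1 + Real.log (α * u + α' * v)) := by
  classical
  rcases S.eq_empty_or_nonempty with rfl | ⟨x₀, hx₀⟩
  · have : (1 : ℝ) ≤ 1 ∧ 0 ≤ Real.log (α * u + α' * v) := ⟨le_rfl, by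
      have := Real.log_natCast_nonneg (α * u + α' * v)
      push_cast at this
      exact this⟩
    simp only [Finset.sum_empty]
    have := this.2
    positivity
  set g := Nat.gcd u v
  have hg : 0 < g := Nat.gcd_pos_of_pos_left _ hu
  obtain ⟨u₁, hu₁⟩ : g ∣ u := Nat.gcd_dvd_left u v
  obtain ⟨v₁, hv₁⟩ : g ∣ v := Nat.gcd_dvd_right u v
  have hcop : Nat.Coprime u₁ v₁ := by
    have := Nat.coprime_div_gcd_div_gcd (m := u) (n := v) hg
    have e1 : u / Nat.gcd u v = u₁ := Nat.div_eq_of_eq_mul_right hg hu₁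
    have e2 : v / Nat.gcd u v = v₁ := Nat.div_eq_of_eq_mul_right hg hv₁
    rwa [e1, e2] at this
  have hv₁pos : 0 < v₁ := Nat.pos_of_ne_zero fun h => by simp [h] at hv₁; omega
  have hu₁pos : 0 < u₁ := Nat.pos_of_ne_zero fun h => by simp [h] at hu₁; omega
  have hgR : (0 : ℝ) < g := by exact_mod_cast hg
  have hvR : (0 : ℝ) < v₁ := by exact_mod_cast hv₁pos
  set f : ℕ × ℕ → ℤ := fun x => (x.1 : ℤ) * u₁ - x.2 * v₁
  have habs : ∀ x, |((x.1 * u : ℝ) - x.2 * v)| = g * ((f x).natAbs : ℝ) := by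
    intro x
    rw [Nat.cast_natAbs, hu₁, hv₁]
    push_cast
    have : (x.1 : ℝ) * (g * u₁) - x.2 * (g * v₁) = g * (x.1 * u₁ - x.2 * v₁) := by ring
    rw [this, abs_mul, abs_of_pos hgR]
    simp [f]
  set S' := S.filter (f · ≠ 0)
  have hsum : ∑ x ∈ S, |((x.1 * u : ℝ) - x.2 * v)|⁻¹ =
      (g : ℝ)⁻¹ * ∑ x ∈ S', ((f x).natAbs : ℝ)⁻¹ := by
    rw [Finset.mul_sum]
    simp_rw [habs, mul_inv]
    symm
    refine Finset.sum_subset (Finset.filter_subset _ _) fun x hx hx' => ?_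
    have : f x = 0 := by
      by_contra h
      exact hx' (Finset.mem_filter.2 ⟨hx, h⟩)
    simp [this]
  have hmain := sum_inv_natAbs_le S' f (α * u₁ + α' * v₁) (α / v₁ + 1)
    (fun x hx => (Finset.mem_filter.1 hx).2) (fun x hx => by
      have hx' := Finset.mem_product.1 (hS (Finset.mem_filter.1 hx).1)
      have h1 := Nat.mul_le_mul_right u₁ (Finset.mem_Ioc.1 hx'.1).2
      have h2 := Nat.mul_le_mul_right v₁ (Finset.mem_Ioc.1 hx'.2).2
      simp only [f]
      zify at h1 h2 ⊢
      have p1 : (0 : ℤ) ≤ x.1 * u₁ := by positivity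
      have p2 : (0 : ℤ) ≤ x.2 * v₁ := by positivity
      rw [abs_le]
      constructor <;> linarith)
    (card_linear_fiber_le hcop hv₁pos S' ((Finset.filter_subset _ _).trans hS))
  rw [hsum]
  have hx₀' := Finset.mem_product.1 (hS hx₀)
  have hα : 0 < α := (Finset.mem_Ioc.1 hx₀'.1).1.trans_le (Finset.mem_Ioc.1 hx₀'.1).2
  have hJ : Real.log ((α * u₁ + α' * v₁ : ℕ) : ℝ) ≤ Real.log (α * u + α' * v) := by
    apply Real.log_le_log
    · exact_mod_cast Nat.add_pos_left (Nat.mul_pos hα hu₁pos) _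
    · have h1 : u₁ ≤ u := by rw [hu₁]; exact Nat.le_mul_of_pos_left _ hg
      have h2 : v₁ ≤ v := by rw [hv₁]; exact Nat.le_mul_of_pos_left _ hg
      have : α * u₁ + α' * v₁ ≤ α * u + α' * v := by gcongr
      exact_mod_cast this
  have hlog0 : 0 ≤ Real.log ((α * u₁ + α' * v₁ : ℕ) : ℝ) := Real.log_natCast_nonneg _
  have hK : (g : ℝ)⁻¹ * ((α / v₁ + 1 : ℕ) : ℝ) ≤ α / v + 1 := by
    have h1 : ((α / v₁ : ℕ) : ℝ) ≤ α / v₁ := Nat.cast_div_le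
    have h2 : (g : ℝ)⁻¹ ≤ 1 := inv_le_one_of_one_le₀ (by exact_mod_cast hg)
    rw [hv₁]
    push_cast
    calc (g : ℝ)⁻¹ * (((α / v₁ : ℕ) : ℝ) + 1) ≤ (g : ℝ)⁻¹ * (α / v₁ + 1) := by gcongr
      _ = α / (g * v₁) + (g : ℝ)⁻¹ := by field_simp
      _ ≤ _ := by linarith
  calc (g : ℝ)⁻¹ * ∑ x ∈ S', ((f x).natAbs : ℝ)⁻¹
      ≤ (g : ℝ)⁻¹ * (2 * ((α / v₁ + 1 : ℕ) : ℝ) * (1 + Real.log ((α * u₁ + α' * v₁ : ℕ) : ℝ))) :=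
        mul_le_mul_of_nonneg_left hmain (by positivity)
    _ = 2 * ((g : ℝ)⁻¹ * ((α / v₁ + 1 : ℕ) : ℝ)) *
        (1 + Real.log ((α * u₁ + α' * v₁ : ℕ) : ℝ)) := by ring
    _ ≤ _ := by gcongr

lemma abs_sub_mul_pow_le_abs_pow_sub_pow {x y L : ℝ} (hL : 0 ≤ L) (hx : L ≤ x) (hy : L ≤ y) {n : ℕ}
    (hn : 0 < n) : |x - y| * L ^ (n - 1) ≤ |x ^ n - y ^ n| := by
  wlog h : y ≤ x generalizing x y
  · rw [abs_sub_comm x, abs_sub_comm (x ^ n)]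
    exact this hy hx (le_of_not_ge h)
  have h1 := sub_mul_pow_le_pow_sub_pow (hL.trans hy) h hn
  rw [abs_of_nonneg (sub_nonneg.2 h)]
  calc (x - y) * L ^ (n - 1) ≤ (x - y) * x ^ (n - 1) :=
        mul_le_mul_of_nonneg_left (pow_le_pow_left₀ hL hx _) (sub_nonneg.2 h)
    _ ≤ _ := h1.trans (le_abs_self _)

/-- With `m = n l` the determinant is `X ^ n - Y ^ n` for `X = a b'^l`, `Y = a' b^l`, both `≫ α α'`,
so it exceeds `|X - Y|` by a factor `≫ (α α')^(n-1)`. For fixed `b, b'` the difference `X - Y` is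
linear in `(a, a')`, with level sets of bounded size since `β ^ l = α`. -/
lemma sum_inv_powDet_le_of_dvd {n l α β α' β' : ℕ} (hn : 0 < n) (hβ : 0 < β) (hβ' : 0 < β')
    (hα : β ^ l = α) (hα' : β' ^ l = α') :
    ∑ x ∈ coprimeBlock α β, ∑ y ∈ coprimeBlock α' β', |(powDet n (n * l) x y : ℝ)|⁻¹ ≤
      ((8 : ℝ) ^ (1 + l) / (α * α')) ^ (n - 1) * ((β * β') *
        (2 * (8 ^ l + 1) * (1 + Real.log (2 * α * α')))) := by
  classical
  have hα0 : 0 < α := hα ▸ pow_pos hβ l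
  have hα0' : 0 < α' := hα' ▸ pow_pos hβ' l
  have hαR : (0 : ℝ) < α := by exact_mod_cast hα0
  have hαR' : (0 : ℝ) < α' := by exact_mod_cast hα0'
  set F : (ℕ × ℕ) × (ℕ × ℕ) → ℝ := fun z =>
    |((z.1.1 * (z.2.2 ^ l : ℕ) : ℝ) - z.2.1 * (z.1.2 ^ l : ℕ))|⁻¹ with hF
  have hpoint : ∀ x ∈ coprimeBlock α β, ∀ y ∈ coprimeBlock α' β',
      |(powDet n (n * l) x y : ℝ)|⁻¹ ≤ ((8 : ℝ) ^ (1 + l) / (α * α')) ^ (n - 1) * F (x, y) := by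
    intro x hx y hy
    rw [mem_coprimeBlock] at hx hy
    set L : ℝ := (α * α') / 8 ^ (1 + l)
    have hL : 0 < L := by positivity
    have hX : L ≤ x.1 * (y.2 ^ l : ℕ) := by
      rw [div_le_iff₀ (by positivity)]
      have h1 : α ≤ 8 * x.1 := hx.2.1.le
      have h2 : α' ≤ (8 * y.2) ^ l := hα' ▸ Nat.pow_le_pow_left hy.2.2.1.le l
      have h3 : α * α' ≤ x.1 * y.2 ^ l * 8 ^ (1 + l) := by
        calc α * α' ≤ (8 * x.1) * (8 * y.2) ^ l := Nat.mul_le_mul h1 h2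
          _ = _ := by ring
      exact_mod_cast h3
    have hY : L ≤ y.1 * (x.2 ^ l : ℕ) := by
      rw [div_le_iff₀ (by positivity)]
      have h1 : α' ≤ 8 * y.1 := hy.2.1.le
      have h2 : α ≤ (8 * x.2) ^ l := hα ▸ Nat.pow_le_pow_left hx.2.2.1.le l
      have h3 : α * α' ≤ y.1 * x.2 ^ l * 8 ^ (1 + l) := by
        calc α * α' ≤ (8 * x.2) ^ l * (8 * y.1) := Nat.mul_le_mul h2 h1
          _ = _ := by ring
      exact_mod_cast h3
    have hdet : (powDet n (n * l) x y : ℝ) =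
        (x.1 * (y.2 ^ l : ℕ) : ℝ) ^ n - (y.1 * (x.2 ^ l : ℕ) : ℝ) ^ n := by
      simp only [powDet]
      push_cast
      ring
    have key := abs_sub_mul_pow_le_abs_pow_sub_pow hL.le hX hY hn
    rw [← hdet] at key
    have hinv : ((8 : ℝ) ^ (1 + l) / (α * α')) ^ (n - 1) = (L ^ (n - 1))⁻¹ := by
      rw [← inv_pow, inv_div]
    rw [hinv]
    simp only [hF]
    rw [← mul_inv]
    rcases eq_or_ne ((x.1 * (y.2 ^ l : ℕ) : ℝ) - y.1 * (x.2 ^ l : ℕ)) 0 with h0 | h0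
    · have : (powDet n (n * l) x y : ℝ) = 0 := by
        rw [hdet, sub_eq_zero.1 h0, sub_self]
      rw [this, h0]
      simp
    · apply inv_anti₀ (mul_pos (by positivity) (abs_pos.2 h0))
      rwa [mul_comm]
  have hlog : 0 ≤ Real.log (2 * α * α') := by
    apply Real.log_nonneg
    have h1 : (1 : ℝ) ≤ α := by exact_mod_cast hα0
    have h2 : (1 : ℝ) ≤ α' := by exact_mod_cast hα0'
    nlinarith
  have hsum : ∑ z ∈ coprimeBlock α β ×ˢ coprimeBlock α' β', F z ≤
      (β * β') * (2 * (8 ^ l + 1) * (1 + Real.log (2 * α * α'))) := by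
    have hmaps : ∀ z ∈ coprimeBlock α β ×ˢ coprimeBlock α' β',
        (z.1.2, z.2.2) ∈ Finset.Ioc 0 β ×ˢ Finset.Ioc 0 β' := by
      intro z hz
      rw [Finset.mem_product, mem_coprimeBlock, mem_coprimeBlock] at hz
      simp only [Finset.mem_product, Finset.mem_Ioc]
      exact ⟨hz.1.1.2, hz.2.1.2⟩
    rw [← Finset.sum_fiberwise_of_maps_to hmaps]
    calc _ ≤ ∑ w ∈ Finset.Ioc 0 β ×ˢ Finset.Ioc 0 β',
          2 * (8 ^ l + 1) * (1 + Real.log (2 * α * α')) := by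
          refine Finset.sum_le_sum fun w hw => ?_
          set T := (coprimeBlock α β ×ˢ coprimeBlock α' β').filter
            (fun z => (z.1.2, z.2.2) = w) with hT
          rcases T.eq_empty_or_nonempty with h | ⟨z₀, hz₀⟩
          · rw [h]
            simp only [Finset.sum_empty]
            positivity
          have hTm : ∀ z ∈ T, z.1 ∈ coprimeBlock α β ∧ z.2 ∈ coprimeBlock α' β' ∧
              z.1.2 = w.1 ∧ z.2.2 = w.2 := by
            intro z hz
            have h1 := Finset.mem_filter.1 hz
            have h2 := Finset.mem_product.1 h1.1
            exact ⟨h2.1, h2.2, (Prod.ext_iff.1 h1.2).1, (Prod.ext_iff.1 h1.2).2⟩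
          have hinj : Set.InjOn (fun z : (ℕ × ℕ) × (ℕ × ℕ) => (z.1.1, z.2.1)) T := by
            rintro ⟨⟨a, b⟩, ⟨c, d⟩⟩ hz ⟨⟨a', b'⟩, ⟨c', d'⟩⟩ hz' he
            have h1 := hTm _ hz
            have h2 := hTm _ hz'
            simp only [Prod.mk.injEq] at he h1 h2 ⊢
            exact ⟨⟨he.1, h1.2.2.1.trans h2.2.2.1.symm⟩,
              ⟨he.2, h1.2.2.2.trans h2.2.2.2.symm⟩⟩
          have hz₀' := hTm z₀ hz₀
          have hb := mem_coprimeBlock.1 hz₀'.1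
          have hb' := mem_coprimeBlock.1 hz₀'.2.1
          rw [hz₀'.2.2.1] at hb
          rw [hz₀'.2.2.2] at hb'
          have hsub : T.image (fun z => (z.1.1, z.2.1)) ⊆ Finset.Ioc 0 α ×ˢ Finset.Ioc 0 α' := by
            intro v hv
            obtain ⟨z, hz, rfl⟩ := Finset.mem_image.1 hv
            have h1 := hTm z hz
            simp only [Finset.mem_product, Finset.mem_Ioc]
            exact ⟨(mem_coprimeBlock.1 h1.1).1.1, (mem_coprimeBlock.1 h1.2.1).1.1⟩
          have hu : 0 < w.2 ^ l := pow_pos hb'.1.2.1 l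
          have hv : 0 < w.1 ^ l := pow_pos hb.1.2.1 l
          have h1 := sum_inv_linear_le hu hv _ hsub
          rw [Finset.sum_image hinj] at h1
          have h2 : ∑ z ∈ T, F z =
              ∑ z ∈ T, |((z.1.1 * (w.2 ^ l : ℕ) : ℝ) - z.2.1 * (w.1 ^ l : ℕ))|⁻¹ := by
            refine Finset.sum_congr rfl fun z hz => ?_
            have h3 := hTm z hz
            simp only [hF]
            rw [h3.2.2.1, h3.2.2.2]
          rw [h2]
          refine h1.trans ?_
          have hvR : (0 : ℝ) < (w.1 ^ l : ℕ) := by exact_mod_cast hv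
          have huR : (0 : ℝ) < (w.2 ^ l : ℕ) := by exact_mod_cast hu
          have h4 : (α : ℝ) / (w.1 ^ l : ℕ) ≤ 8 ^ l := by
            rw [div_le_iff₀ hvR]
            have : α ≤ 8 ^ l * w.1 ^ l := by
              rw [← mul_pow, ← hα]
              exact Nat.pow_le_pow_left hb.2.2.1.le l
            exact_mod_cast this
          have h5 : Real.log (α * (w.2 ^ l : ℕ) + α' * (w.1 ^ l : ℕ)) ≤
              Real.log (2 * α * α') := by
            apply Real.log_le_log (by positivity)
            have h6 : ((w.2 ^ l : ℕ) : ℝ) ≤ α' := by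
              exact_mod_cast hα' ▸ Nat.pow_le_pow_left hb'.1.2.2 l
            have h7 : ((w.1 ^ l : ℕ) : ℝ) ≤ α := by
              exact_mod_cast hα ▸ Nat.pow_le_pow_left hb.1.2.2 l
            have h8 := mul_le_mul_of_nonneg_left h6 hαR.le
            have h9 := mul_le_mul_of_nonneg_left h7 hαR'.le
            linarith
          have h10 : 0 ≤ Real.log (α * (w.2 ^ l : ℕ) + α' * (w.1 ^ l : ℕ)) := by
            have := Real.log_natCast_nonneg (α * w.2 ^ l + α' * w.1 ^ l)
            push_cast at this ⊢
            exact this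
          gcongr
      _ = _ := by
          rw [Finset.sum_const, nsmul_eq_mul, Finset.card_product]
          simp
  rw [← Finset.sum_product']
  calc _ ≤ ∑ z ∈ coprimeBlock α β ×ˢ coprimeBlock α' β',
        ((8 : ℝ) ^ (1 + l) / (α * α')) ^ (n - 1) * F z := by
        refine Finset.sum_le_sum fun z hz => ?_
        have hz' := Finset.mem_product.1 hz
        exact hpoint _ hz'.1 _ hz'.2
    _ ≤ _ := by
        rw [← Finset.mul_sum]
        exact mul_le_mul_of_nonneg_left hsum (by positivity)

/-- With `d = gcd(n, m)` the determinant is `X ^ d - Y ^ d` for distinct integers, hence at least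
`max(X, Y)^(d-1)` in absolute value; as `d ≥ 2`, its square is at least `max(X, Y)^d`, which is
comparable to the product of the two heights. -/
lemma mul_le_powDet_sq {n m α β α' β' : ℕ} (hnm : 2 ≤ Nat.gcd n m) (hα : α ^ n = β ^ m)
    (hα' : α' ^ n = β' ^ m) {x y : ℕ × ℕ} (hx : x ∈ coprimeBlock α β)
    (hy : y ∈ coprimeBlock α' β') (h0 : powDet n m x y ≠ 0) :
    (α ^ n * α' ^ n : ℝ) ≤ 8 ^ (n + m) * (powDet n m x y : ℝ) ^ 2 := by
  rw [mem_coprimeBlock] at hx hy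
  obtain ⟨n', hn'⟩ := Nat.gcd_dvd_left n m
  obtain ⟨m', hm'⟩ := Nat.gcd_dvd_right n m
  set d := Nat.gcd n m
  set X : ℕ := x.1 ^ n' * y.2 ^ m'
  set Y : ℕ := y.1 ^ n' * x.2 ^ m'
  have hXd : X ^ d = x.1 ^ n * y.2 ^ m := by
    rw [hn', hm', mul_comm d, mul_comm d, pow_mul, pow_mul, ← mul_pow]
  have hYd : Y ^ d = y.1 ^ n * x.2 ^ m := by
    rw [hn', hm', mul_comm d, mul_comm d, pow_mul, pow_mul, ← mul_pow]
  have hdet : (powDet n m x y : ℝ) = (X : ℝ) ^ d - (Y : ℝ) ^ d := by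
    have : powDet n m x y = ((X ^ d : ℕ) : ℤ) - ((Y ^ d : ℕ) : ℤ) := by
      rw [hXd, hYd]
      simp [powDet]
    rw [this]
    push_cast
    rfl
  have hX : α ^ n * α' ^ n ≤ 8 ^ (n + m) * X ^ d := by
    rw [hXd, hα']
    calc α ^ n * β' ^ m ≤ (8 * x.1) ^ n * (8 * y.2) ^ m :=
          Nat.mul_le_mul (Nat.pow_le_pow_left hx.2.1.le n) (Nat.pow_le_pow_left hy.2.2.1.le m)
      _ = _ := by ring
  have hY : α ^ n * α' ^ n ≤ 8 ^ (n + m) * Y ^ d := by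
    rw [hYd, hα]
    calc β ^ m * α' ^ n ≤ (8 * x.2) ^ m * (8 * y.1) ^ n :=
          Nat.mul_le_mul (Nat.pow_le_pow_left hx.2.2.1.le m) (Nat.pow_le_pow_left hy.2.1.le n)
      _ = _ := by ring
  have key : ∀ U V : ℕ, V < U → (U : ℝ) ^ d ≤ ((U : ℝ) ^ d - (V : ℝ) ^ d) ^ 2 := by
    intro U V h
    have hU : (1 : ℝ) ≤ U := by exact_mod_cast (by omega : 1 ≤ U)
    have hUV : (1 : ℝ) ≤ U - V := by
      have : (V : ℝ) + 1 ≤ U := by exact_mod_cast h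
      linarith
    have h1 := sub_mul_pow_le_pow_sub_pow (Nat.cast_nonneg (α := ℝ) V)
      (Nat.cast_le.2 h.le) (p := d) (by omega)
    have h2 : (U : ℝ) ^ (d - 1) ≤ (U : ℝ) ^ d - (V : ℝ) ^ d := by
      refine le_trans ?_ h1
      exact le_mul_of_one_le_left (by positivity) hUV
    calc (U : ℝ) ^ d ≤ ((U : ℝ) ^ (d - 1)) ^ 2 := by
          rw [← pow_mul]
          exact pow_le_pow_right₀ hU (by omega)
      _ ≤ _ := pow_le_pow_left₀ (by positivity) h2 2
  have hXY : X ≠ Y := by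
    intro h
    apply h0
    have : (powDet n m x y : ℝ) = 0 := by rw [hdet, h, sub_self]
    exact_mod_cast this
  rw [hdet]
  rcases lt_or_gt_of_ne hXY with h | h
  · refine (show (α ^ n * α' ^ n : ℝ) ≤ 8 ^ (n + m) * (Y : ℝ) ^ d by exact_mod_cast hY).trans ?_
    rw [sub_sq_comm]
    exact mul_le_mul_of_nonneg_left (key _ _ h) (by positivity)
  · refine (show (α ^ n * α' ^ n : ℝ) ≤ 8 ^ (n + m) * (X : ℝ) ^ d by exact_mod_cast hX).trans ?_
    exact mul_le_mul_of_nonneg_left (key _ _ h) (by positivity)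

/-! ### Geometric blocks and reciprocal determinant sums across two blocks. -/

/-- The `k`-th block: coprime pairs `(a, b)` with `a ^ n` and `b ^ m` comparable to
`8 ^ (k n m p)`. -/
def pairBlock (n m p k : ℕ) : Finset (ℕ × ℕ) := coprimeBlock (8 ^ (k * (m * p))) (8 ^ (k * (n * p)))

/-- The proportion of the pairs of the `k`-th block to their common height. -/
noncomputable def blockDensity (n m p k : ℕ) : ℝ :=
  8 ^ (k * (m * p)) * 8 ^ (k * (n * p)) / 8 ^ (k * (n * m * p))

lemma blockDensity_pos (n m p k : ℕ) : 0 < blockDensity n m p k := by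
  unfold blockDensity
  positivity

lemma blockDensity_comm (n m p k : ℕ) : blockDensity n m p k = blockDensity m n p k := by
  unfold blockDensity
  rw [mul_comm ((8 : ℝ) ^ (k * (m * p))), mul_comm n m]

/-- The bound is shaped for the overlap error: multiplied by `δ_k δ_k' G_k`, its right side becomes
`C 2^(-(k'-k)) M_k M_k'`. There is a factor `G_k'` to spare, which absorbs the logarithm and
supplies the decay. -/
lemma sum_inv_powDet_pairBlock_le_of_dvd {n l p : ℕ} (hn : 0 < n) (hl : 0 < l) :
    ∃ C : ℝ, 0 ≤ C ∧ ∀ k k' : ℕ, k ≤ k' →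
      ∑ x ∈ pairBlock n (n * l) p k, ∑ y ∈ pairBlock n (n * l) p k',
        |(powDet n (n * l) x y : ℝ)|⁻¹ ≤ C * (1 / 2) ^ (k' - k) *
          (blockDensity n (n * l) p k * blockDensity n (n * l) p k' * 8 ^ (k' * (n * (n * l)))) := by
  set m := n * l with hm
  refine ⟨((8 : ℝ) ^ (1 + l)) ^ (n - 1) * (2 * (8 ^ l + 1) * (2 + 6 * (m * p))), by positivity,
    fun k k' hkk => ?_⟩
  have e1 : ∀ j : ℕ, (8 ^ (j * (n * p))) ^ l = 8 ^ (j * (m * p)) := fun j => by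
    rw [← pow_mul, hm]
    ring_nf
  have h := sum_inv_powDet_le_of_dvd (n := n) (l := l) (α := 8 ^ (k * (m * p)))
    (β := 8 ^ (k * (n * p))) (α' := 8 ^ (k' * (m * p))) (β' := 8 ^ (k' * (n * p))) hn
    (by positivity) (by positivity) (e1 k) (e1 k')
  push_cast at h
  refine h.trans ?_
  have hlog8 : Real.log 8 ≤ 3 := by
    have : (8 : ℝ) = 2 ^ (3 : ℕ) := by norm_num
    rw [this, Real.log_pow]
    have := Real.log_two_lt_d9
    push_cast
    linarith
  have hlog : 1 + Real.log (2 * (8 : ℝ) ^ (k * (m * p)) * 8 ^ (k' * (m * p))) ≤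
      (2 + 6 * (m * p)) * 4 ^ k' := by
    rw [mul_assoc, ← pow_add, Real.log_mul (by norm_num) (by positivity), Real.log_pow]
    have h2 := Real.log_two_lt_d9
    have h3 : ((k * (m * p) + k' * (m * p) : ℕ) : ℝ) ≤ 2 * k' * (m * p) := by
      have : k * (m * p) + k' * (m * p) ≤ 2 * k' * (m * p) := by
        have := Nat.mul_le_mul_right (m * p) hkk
        linarith
      exact_mod_cast this
    have h4 : ((k * (m * p) + k' * (m * p) : ℕ) : ℝ) * Real.log 8 ≤ 2 * k' * (m * p) * 3 :=
      mul_le_mul h3 hlog8 (Real.log_nonneg (by norm_num)) (by positivity)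
    have h5 : (k' : ℝ) ≤ 4 ^ k' := by
      exact_mod_cast (Nat.lt_pow_self (by norm_num : 1 < 4)).le
    have h6 : (1 : ℝ) ≤ 4 ^ k' := one_le_pow₀ (by norm_num)
    have h7 : (k' : ℝ) * (m * p) ≤ 4 ^ k' * (m * p) := by gcongr
    nlinarith
  -- The logarithm was bounded crudely by a multiple of `4 ^ k'` to leave a factor `2 ^ (-k')` below
  -- `8 ^ k'`.
  have hG : (4 : ℝ) ^ k' ≤ (1 / 2) ^ (k' - k) * 8 ^ (k' * (n * m)) := by
    calc (4 : ℝ) ^ k' = (1 / 2) ^ k' * 8 ^ k' := by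
          rw [← mul_pow]
          norm_num
      _ ≤ _ := by
          have : 0 < n * m := by positivity
          refine mul_le_mul ?_ ?_ (by positivity) (by positivity)
          · exact pow_le_pow_of_le_one (by norm_num) (by norm_num) (by omega)
          · exact pow_le_pow_right₀ (by norm_num) (Nat.le_mul_of_pos_right _ this)
  have e2 : ((8 : ℝ) ^ (1 + l) / (8 ^ (k * (m * p)) * 8 ^ (k' * (m * p)))) ^ (n - 1) *
      (8 ^ (k * (n * p)) * 8 ^ (k' * (n * p))) =
      ((8 : ℝ) ^ (1 + l)) ^ (n - 1) * (blockDensity n m p k * blockDensity n m p k') := by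
    have e3 : ∀ j : ℕ, (8 : ℝ) ^ (j * (n * m * p)) =
        (8 ^ (j * (m * p))) ^ (n - 1) * 8 ^ (j * (m * p)) := by
      intro j
      rw [← pow_succ, Nat.sub_add_cancel hn, ← pow_mul]
      ring_nf
    simp only [blockDensity, e3, div_pow, mul_pow]
    field_simp
  rw [← mul_assoc, e2]
  have hd := blockDensity_pos n m p k
  have hd' := blockDensity_pos n m p k'
  calc ((8 : ℝ) ^ (1 + l)) ^ (n - 1) * (blockDensity n m p k * blockDensity n m p k') *
        (2 * (8 ^ l + 1) * (1 + Real.log (2 * (8 : ℝ) ^ (k * (m * p)) * 8 ^ (k' * (m * p)))))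
      ≤ ((8 : ℝ) ^ (1 + l)) ^ (n - 1) * (blockDensity n m p k * blockDensity n m p k') *
        (2 * (8 ^ l + 1) * ((2 + 6 * (m * p)) * ((1 / 2) ^ (k' - k) * 8 ^ (k' * (n * m))))) := by
        gcongr
        exact hlog.trans (by gcongr)
    _ = _ := by ring

/-- A bound for each term suffices: `|D| ≫ √(H_k H_k') ≥ 2^(k'-k) H_k`, and there are at most `N_k
N_k'` pairs. Here `p = 1` matters because then `H_k' = G_k'`. -/
lemma sum_inv_powDet_pairBlock_le_of_two_le_gcd {n m : ℕ} (hn : 0 < n) (hm : 0 < m)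
    (hnm : 2 ≤ Nat.gcd n m) :
    ∃ C : ℝ, 0 ≤ C ∧ ∀ k k' : ℕ, k ≤ k' →
      ∑ x ∈ pairBlock n m 1 k, ∑ y ∈ pairBlock n m 1 k',
        |(powDet n m x y : ℝ)|⁻¹ ≤ C * (1 / 2) ^ (k' - k) *
          (blockDensity n m 1 k * blockDensity n m 1 k' * 8 ^ (k' * (n * m))) := by
  refine ⟨8 ^ (n + m), by positivity, fun k k' hkk => ?_⟩
  have hpt : ∀ x ∈ pairBlock n m 1 k, ∀ y ∈ pairBlock n m 1 k',
      |(powDet n m x y : ℝ)|⁻¹ ≤ 8 ^ (n + m) * (1 / 2) ^ (k' - k) / 8 ^ (k * (n * m)) := by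
    intro x hx y hy
    rcases eq_or_ne (powDet n m x y) 0 with h0 | h0
    · rw [h0]
      simp only [Int.cast_zero, abs_zero, inv_zero]
      positivity
    have h1 := mul_le_powDet_sq hnm (by rw [← pow_mul, ← pow_mul]; ring_nf)
      (by rw [← pow_mul, ← pow_mul]; ring_nf) hx hy h0
    push_cast at h1
    rw [← pow_mul, ← pow_mul] at h1
    have e : ∀ j : ℕ, j * (m * 1) * n = j * (n * m) := fun j => by ring
    rw [e, e] at h1
    have hD : 0 < |(powDet n m x y : ℝ)| := abs_pos.2 (by exact_mod_cast h0)
    set D := |(powDet n m x y : ℝ)|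
    rw [← sq_abs] at h1
    have h2 : (8 : ℝ) ^ (k * (n * m)) * 2 ^ (k' - k) ≤ 8 ^ (n + m) * D := by
      refine le_of_pow_le_pow_left₀ two_ne_zero (by positivity) ?_
      have h3 : ((2 : ℝ) ^ (k' - k)) ^ 2 * 8 ^ (k * (n * m)) ≤ 8 ^ (k' * (n * m)) := by
        obtain ⟨j, rfl⟩ := Nat.exists_eq_add_of_le hkk
        have h4 : ((2 : ℝ) ^ j) ^ 2 ≤ 8 ^ (j * (n * m)) := by
          calc ((2 : ℝ) ^ j) ^ 2 = 4 ^ j := by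
                rw [← pow_mul, mul_comm, pow_mul]
                norm_num
            _ ≤ 8 ^ j := pow_le_pow_left₀ (by norm_num) (by norm_num) j
            _ ≤ _ := pow_le_pow_right₀ (by norm_num)
                (Nat.le_mul_of_pos_right _ (by positivity))
        rw [Nat.add_sub_cancel_left, add_mul, pow_add, mul_comm]
        exact mul_le_mul_of_nonneg_left h4 (by positivity)
      have h5 : (1 : ℝ) ≤ 8 ^ (n + m) := one_le_pow₀ (by norm_num)
      calc ((8 : ℝ) ^ (k * (n * m)) * 2 ^ (k' - k)) ^ 2
          = 8 ^ (k * (n * m)) * ((2 ^ (k' - k)) ^ 2 * 8 ^ (k * (n * m))) := by ring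
        _ ≤ 8 ^ (k * (n * m)) * 8 ^ (k' * (n * m)) := by gcongr
        _ ≤ 8 ^ (n + m) * D ^ 2 := h1
        _ ≤ 8 ^ (n + m) * (8 ^ (n + m) * D ^ 2) :=
            le_mul_of_one_le_left (by positivity) h5
        _ = _ := by ring
    rw [one_div, inv_pow, ← div_eq_mul_inv, div_div, inv_eq_one_div,
      div_le_div_iff₀ hD (by positivity), one_mul, mul_comm ((2 : ℝ) ^ (k' - k))]
    exact h2
  have hcard : ∀ j, ((pairBlock n m 1 j).card : ℝ) ≤ 8 ^ (j * (m * 1)) * 8 ^ (j * (n * 1)) := by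
    intro j
    exact_mod_cast card_coprimeBlock_le _ _
  calc _ ≤ ∑ x ∈ pairBlock n m 1 k, ∑ y ∈ pairBlock n m 1 k',
        (8 ^ (n + m) * (1 / 2) ^ (k' - k) / 8 ^ (k * (n * m)) : ℝ) :=
        Finset.sum_le_sum fun x hx => Finset.sum_le_sum fun y hy => hpt x hx y hy
    _ = ((pairBlock n m 1 k).card : ℝ) * ((pairBlock n m 1 k').card : ℝ) *
        (8 ^ (n + m) * (1 / 2) ^ (k' - k) / 8 ^ (k * (n * m))) := by
        simp only [Finset.sum_const, nsmul_eq_mul]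
        ring
    _ ≤ (8 ^ (k * (m * 1)) * 8 ^ (k * (n * 1))) * (8 ^ (k' * (m * 1)) * 8 ^ (k' * (n * 1))) *
        (8 ^ (n + m) * (1 / 2) ^ (k' - k) / 8 ^ (k * (n * m))) := by
        gcongr
        · exact hcard k
        · exact hcard k'
    _ = _ := by
        simp only [blockDensity, mul_one]
        field_simp

lemma powDet_swap (n m : ℕ) (x y : ℕ × ℕ) : powDet m n x.swap y.swap = -powDet n m x y := by
  simp only [powDet, Prod.fst_swap, Prod.snd_swap]
  ring

lemma swap_mem_coprimeBlock {α β : ℕ} {v : ℕ × ℕ} :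
    v.swap ∈ coprimeBlock β α ↔ v ∈ coprimeBlock α β := by
  simp only [mem_coprimeBlock, Prod.fst_swap, Prod.snd_swap, Nat.coprime_comm (n := v.1)]
  tauto

lemma sum_pairBlock_swap (n m p k : ℕ) (f : ℕ × ℕ → ℝ) :
    ∑ x ∈ pairBlock m n p k, f x = ∑ x ∈ pairBlock n m p k, f x.swap := by
  refine Finset.sum_equiv (Equiv.prodComm ℕ ℕ) (fun x => ?_) (fun x _ => by simp)
  simp only [Equiv.prodComm_apply]
  exact swap_mem_coprimeBlock.symm

lemma exists_sum_inv_powDet_pairBlock_le {n m p : ℕ} (hn : 0 < n) (hm : 0 < m)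
    (h : n ∣ m ∨ m ∣ n ∨ (p = 1 ∧ 2 ≤ Nat.gcd n m)) :
    ∃ C : ℝ, 0 ≤ C ∧ ∀ k k' : ℕ, k ≤ k' →
      ∑ x ∈ pairBlock n m p k, ∑ y ∈ pairBlock n m p k',
        |(powDet n m x y : ℝ)|⁻¹ ≤ C * (1 / 2) ^ (k' - k) *
          (blockDensity n m p k * blockDensity n m p k' * 8 ^ (k' * (n * m))) := by
  rcases h with ⟨l, rfl⟩ | ⟨l, rfl⟩ | ⟨rfl, h⟩
  · exact sum_inv_powDet_pairBlock_le_of_dvd hn (Nat.pos_of_mul_pos_left hm)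
  · obtain ⟨C, hC, hs⟩ := sum_inv_powDet_pairBlock_le_of_dvd (n := m) (l := l) (p := p) hm
      (Nat.pos_of_mul_pos_left hn)
    refine ⟨C, hC, fun k k' hk => ?_⟩
    have := hs k k' hk
    rw [sum_pairBlock_swap] at this
    simp_rw [sum_pairBlock_swap (m * l) m, powDet_swap] at this
    simp only [Int.cast_neg, abs_neg] at this
    rw [blockDensity_comm m, blockDensity_comm m, mul_comm m (m * l)] at this
    exact this
  · exact sum_inv_powDet_pairBlock_le_of_two_le_gcd hn hm h

/-! ### Second moments, limsup sets and Lebesgue density. -/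

/-- The **Chung–Erdős inequality**. -/
lemma sq_sum_measureReal_le {Ω ι : Type*} [MeasurableSpace Ω] (μ : Measure Ω) [IsFiniteMeasure μ]
    (s : Finset ι) (E : ι → Set Ω) (hE : ∀ i, MeasurableSet (E i)) :
    (∑ i ∈ s, μ.real (E i)) ^ 2 ≤
      μ.real (⋃ i ∈ s, E i) * ∑ i ∈ s, ∑ j ∈ s, μ.real (E i ∩ E j) := by
  set U := ⋃ i ∈ s, E i
  have hU : MeasurableSet U := Finset.measurableSet_biUnion s fun i _ => hE i
  have hint : ∀ A : Set Ω, MeasurableSet A → Integrable (A.indicator fun _ => (1 : ℝ)) μ :=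
    fun A hA => (integrable_const 1).indicator hA
  have hval : ∀ A : Set Ω, MeasurableSet A → ∫ x, A.indicator (fun _ => (1 : ℝ)) x ∂μ = μ.real A :=
    fun A hA => by rw [integral_indicator_const _ hA, smul_eq_mul, mul_one]
  -- The quadratic in `t` is the integral of `(∑ 1_{E i} - t 1_U)²`; the inequality is the sign of
  -- its discriminant, using that the counting function vanishes off `U`.
  have key : ∀ t : ℝ, 0 ≤ μ.real U * (t * t) + (-2 * ∑ i ∈ s, μ.real (E i)) * t +
      ∑ i ∈ s, ∑ j ∈ s, μ.real (E i ∩ E j) := by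
    intro t
    have hpt : ∀ x, (∑ i ∈ s, (E i).indicator (fun _ => (1 : ℝ)) x -
        t * U.indicator (fun _ => (1 : ℝ)) x) ^ 2 =
        (∑ i ∈ s, ∑ j ∈ s, (E i ∩ E j).indicator (fun _ => (1 : ℝ)) x) +
        (-2 * t) * (∑ i ∈ s, (E i).indicator (fun _ => (1 : ℝ)) x) +
        (t * t) * U.indicator (fun _ => (1 : ℝ)) x := by
      intro x
      have h1 : ∀ i j, (E i ∩ E j).indicator (fun _ => (1 : ℝ)) x =
          (E i).indicator (fun _ => (1 : ℝ)) x * (E j).indicator (fun _ => (1 : ℝ)) x := by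
        intro i j
        by_cases hi : x ∈ E i <;> by_cases hj : x ∈ E j <;> simp [hi, hj]
      simp_rw [h1, ← Finset.mul_sum, ← Finset.sum_mul]
      by_cases hx : x ∈ U
      · rw [indicator_of_mem hx]
        ring
      · have h2 : ∑ i ∈ s, (E i).indicator (fun _ => (1 : ℝ)) x = 0 := by
          refine Finset.sum_eq_zero fun i hi => indicator_of_notMem (fun h => hx ?_) _
          exact mem_biUnion (Finset.mem_coe.2 hi) h
        rw [indicator_of_notMem hx, h2]
        ring
    have h0 : 0 ≤ ∫ x, (∑ i ∈ s, (E i).indicator (fun _ => (1 : ℝ)) x -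
        t * U.indicator (fun _ => (1 : ℝ)) x) ^ 2 ∂μ := integral_nonneg fun x => sq_nonneg _
    simp_rw [hpt] at h0
    have i1 : Integrable (fun x => ∑ i ∈ s, ∑ j ∈ s,
        (E i ∩ E j).indicator (fun _ => (1 : ℝ)) x) μ :=
      integrable_finsetSum _ fun i _ => integrable_finsetSum _ fun j _ =>
        hint _ ((hE i).inter (hE j))
    have i2 : Integrable (fun x => (-2 * t) *
        (∑ i ∈ s, (E i).indicator (fun _ => (1 : ℝ)) x)) μ :=
      (integrable_finsetSum _ fun i _ => hint _ (hE i)).const_mul _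
    have i3 : Integrable (fun x => (∑ i ∈ s, ∑ j ∈ s,
        (E i ∩ E j).indicator (fun _ => (1 : ℝ)) x) +
        (-2 * t) * (∑ i ∈ s, (E i).indicator (fun _ => (1 : ℝ)) x)) μ := i1.add i2
    rw [integral_add i3 ((hint U hU).const_mul _), integral_add i1 i2,
      integral_const_mul, integral_const_mul, hval U hU,
      integral_finsetSum _ fun i _ => integrable_finsetSum _ fun j _ =>
        hint _ ((hE i).inter (hE j)), integral_finsetSum _ fun i _ => hint _ (hE i)] at h0
    simp_rw [integral_finsetSum s fun j _ => hint _ ((hE _).inter (hE j)), hval _ (hE _),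
      hval _ ((hE _).inter (hE _))] at h0
    linarith
  have := discrim_le_zero key
  rw [discrim] at this
  linarith

lemma sum_filter_half_pow_le (s : Finset ℕ) (j : ℕ) :
    ∑ i ∈ s with i ≤ j, (1 / 2 : ℝ) ^ (j - i) ≤ 2 := by
  calc _ ≤ ∑ i ∈ Finset.range (j + 1), (1 / 2 : ℝ) ^ (j - i) := by
        refine Finset.sum_le_sum_of_subset_of_nonneg (fun i hi => ?_) fun _ _ _ => by positivity
        exact Finset.mem_range.2 (Nat.lt_succ_of_le (Finset.mem_filter.1 hi).2)
    _ = ∑ i ∈ Finset.range (j + 1), (1 / 2 : ℝ) ^ i :=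
        Finset.sum_flip fun i => (1 / 2 : ℝ) ^ i
    _ ≤ 2 := sum_geometric_two_le _

/-- The geometric weights sum to at most `2` for each of the two orders of the indices, giving `4
C`; counting the diagonal twice is harmless. -/
lemma sum_sum_le_of_quasi_independent (W : ℕ → ℕ → ℝ) (M : ℕ → ℝ) (hM : ∀ k, 0 ≤ M k) {u C : ℝ}
    (hC : 0 ≤ C) (hsymm : ∀ i j, W i j = W j i) (s : Finset ℕ)
    (hW : ∀ i ∈ s, ∀ j ∈ s, i ≤ j → W i j ≤ u * (M i * M j) + C * (1 / 2) ^ (j - i) * M j) :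
    ∑ i ∈ s, ∑ j ∈ s, W i j ≤ u * (∑ i ∈ s, M i) ^ 2 + 4 * C * ∑ i ∈ s, M i := by
  have h1 : ∀ i ∈ s, ∀ j ∈ s, W i j ≤ u * (M i * M j) +
      ((if i ≤ j then C * (1 / 2) ^ (j - i) * M j else 0) +
        (if j ≤ i then C * (1 / 2) ^ (i - j) * M i else 0)) := by
    intro i hi j hj
    have hMi := hM i
    have hMj := hM j
    rcases le_total i j with h | h
    · have h2 : 0 ≤ (if j ≤ i then C * (1 / 2) ^ (i - j) * M i else 0) := by
        split_ifs <;> positivity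
      rw [if_pos h]
      linarith [hW i hi j hj h]
    · have h2 : 0 ≤ (if i ≤ j then C * (1 / 2) ^ (j - i) * M j else 0) := by
        split_ifs <;> positivity
      rw [if_pos h, hsymm]
      linarith [hW j hj i hi h, mul_comm (M i) (M j)]
  have h3 : ∑ j ∈ s, ∑ i ∈ s, (if i ≤ j then C * (1 / 2) ^ (j - i) * M j else 0) ≤
      2 * C * ∑ j ∈ s, M j := by
    rw [Finset.mul_sum]
    refine Finset.sum_le_sum fun j _ => ?_
    rw [← Finset.sum_filter, ← Finset.sum_mul, ← Finset.mul_sum]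
    have := mul_le_mul_of_nonneg_right
      (mul_le_mul_of_nonneg_left (sum_filter_half_pow_le s j) hC) (hM j)
    linarith
  calc _ ≤ ∑ i ∈ s, ∑ j ∈ s, (u * (M i * M j) +
      ((if i ≤ j then C * (1 / 2) ^ (j - i) * M j else 0) +
        (if j ≤ i then C * (1 / 2) ^ (i - j) * M i else 0))) :=
        Finset.sum_le_sum fun i hi => Finset.sum_le_sum fun j hj => h1 i hi j hj
    _ = u * (∑ i ∈ s, M i) ^ 2 +
        (∑ j ∈ s, ∑ i ∈ s, (if i ≤ j then C * (1 / 2) ^ (j - i) * M j else 0) +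
          ∑ i ∈ s, ∑ j ∈ s, (if j ≤ i then C * (1 / 2) ^ (i - j) * M i else 0)) := by
        simp_rw [Finset.sum_add_distrib]
        rw [Finset.sum_comm (f := fun i j => if i ≤ j then C * (1 / 2) ^ (j - i) * M j else 0),
          sq, Finset.sum_mul_sum]
        simp_rw [Finset.mul_sum]
    _ ≤ _ := by linarith

/-- Over a range `[K, N)` long enough that `S = ∑ M` satisfies `2 C ≤ u S`, the error is absorbed
and the second moment is at most `4 u S²`, so Chung–Erdős bounds each tail union below by `l² / (4
u)`. Continuity from above passes to the limsup. -/
lemma le_measureReal_limsup_of_quasi_independent {Ω ι : Type*} [MeasurableSpace Ω] (μ : Measure Ω)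
    [IsFiniteMeasure μ] (P : ℕ → Finset ι) (E : ℕ → ι → Set Ω)
    (hE : ∀ k v, MeasurableSet (E k v)) (M : ℕ → ℝ) (hM : ∀ k, 0 ≤ M k) (hsum : ¬ Summable M)
    {l u C : ℝ} (hl : 0 ≤ l) (hu : 0 < u) (hC : 0 ≤ C) (k₀ : ℕ)
    (hlo : ∀ k ≥ k₀, l * M k ≤ ∑ v ∈ P k, μ.real (E k v))
    (hhi : ∀ k ≥ k₀, ∀ k' ≥ k, ∑ v ∈ P k, ∑ w ∈ P k', μ.real (E k v ∩ E k' w) ≤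
      u * (M k * M k') + C * (1 / 2) ^ (k' - k) * M k') :
    l ^ 2 / (4 * u) ≤ μ.real {x | ∀ K, ∃ k ≥ K, ∃ v ∈ P k, x ∈ E k v} := by
  set U : ℕ → Set Ω := fun K => ⋃ k ≥ K, ⋃ v ∈ P k, E k v
  have hUmeas : ∀ K, MeasurableSet (U K) := fun K =>
    MeasurableSet.iUnion fun k => MeasurableSet.iUnion fun _ =>
      Finset.measurableSet_biUnion _ fun v _ => hE k v
  have hset : {x | ∀ K, ∃ k ≥ K, ∃ v ∈ P k, x ∈ E k v} = ⋂ K, U K := by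
    ext x
    simp [U]
  have hanti : Antitone U := by
    intro K K' h
    simp only [U]
    exact biUnion_subset_biUnion_left fun k hk => le_trans h hk
  have hlim := tendsto_measure_iInter_atTop (μ := μ) (fun K => (hUmeas K).nullMeasurableSet) hanti
    ⟨0, measure_ne_top _ _⟩
  have hlim' : Tendsto (fun K => μ.real (U K)) atTop (𝓝 (μ.real (⋂ K, U K))) :=
    (ENNReal.tendsto_toReal (measure_ne_top _ _)).comp hlim
  rw [hset]
  refine ge_of_tendsto hlim' (eventually_atTop.2 ⟨k₀, fun K hK => ?_⟩)
  have htend : Tendsto (fun N => ∑ k ∈ Finset.range N, M k) atTop atTop :=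
    (not_summable_iff_tendsto_nat_atTop_of_nonneg hM).1 hsum
  obtain ⟨N, hN, hNK⟩ := ((htend.eventually_ge_atTop
    (2 * C / u + 1 + ∑ k ∈ Finset.range K, M k)).and (eventually_ge_atTop K)).exists
  set S := ∑ k ∈ Finset.Ico K N, M k
  have hS : 2 * C / u + 1 ≤ S := by
    have := Finset.sum_range_add_sum_Ico M hNK
    linarith
  have hS0 : 0 < S := by
    have : 0 ≤ 2 * C / u := by positivity
    linarith
  have hCS : 2 * C ≤ u * S := by
    have h1 : 2 * C / u ≤ S := by linarith
    rw [div_le_iff₀ hu] at h1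
    linarith
  have hCE := sq_sum_measureReal_le μ ((Finset.Ico K N).sigma P)
    (fun i : Σ _ : ℕ, ι => E i.1 i.2) fun i => hE _ _
  simp only [Finset.sum_sigma] at hCE
  have hsub : (⋃ i ∈ (Finset.Ico K N).sigma P, E i.1 i.2) ⊆ U K := by
    intro x hx
    simp only [mem_iUnion, Finset.mem_sigma, Finset.mem_Ico] at hx
    obtain ⟨i, ⟨hi, hv⟩, hx⟩ := hx
    simp only [U, mem_iUnion]
    exact ⟨i.1, hi.1, i.2, hv, hx⟩
  have hlow : l * S ≤ ∑ k ∈ Finset.Ico K N, ∑ v ∈ P k, μ.real (E k v) := by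
    rw [Finset.mul_sum]
    exact Finset.sum_le_sum fun k hk => hlo k (hK.trans (Finset.mem_Ico.1 hk).1)
  have hup := sum_sum_le_of_quasi_independent
    (fun k k' => ∑ v ∈ P k, ∑ w ∈ P k', μ.real (E k v ∩ E k' w)) M hM hC
    (fun i j => by
      rw [Finset.sum_comm]
      simp_rw [inter_comm])
    (Finset.Ico K N) fun i hi j _ hij => hhi i (hK.trans (Finset.mem_Ico.1 hi).1) j hij
  have hre : ∑ k ∈ Finset.Ico K N, ∑ v ∈ P k, ∑ k' ∈ Finset.Ico K N, ∑ w ∈ P k',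
      μ.real (E k v ∩ E k' w) ≤ 4 * u * S ^ 2 := by
    have h1 : ∑ k ∈ Finset.Ico K N, ∑ v ∈ P k, ∑ k' ∈ Finset.Ico K N, ∑ w ∈ P k',
        μ.real (E k v ∩ E k' w) = ∑ k ∈ Finset.Ico K N, ∑ k' ∈ Finset.Ico K N, ∑ v ∈ P k,
          ∑ w ∈ P k', μ.real (E k v ∩ E k' w) :=
      Finset.sum_congr rfl fun k _ => Finset.sum_comm
    rw [h1]
    refine hup.trans ?_
    have := mul_le_mul_of_nonneg_right hCS hS0.le
    nlinarith [sq_nonneg S]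
  have hUK : (l * S) ^ 2 ≤ μ.real (U K) * (4 * u * S ^ 2) := by
    calc (l * S) ^ 2 ≤ (∑ k ∈ Finset.Ico K N, ∑ v ∈ P k, μ.real (E k v)) ^ 2 :=
          pow_le_pow_left₀ (by positivity) hlow 2
      _ ≤ _ := hCE
      _ ≤ _ := mul_le_mul (measureReal_mono hsub (measure_ne_top _ _)) hre
          (by positivity) measureReal_nonneg
  rw [div_le_iff₀ (by positivity)]
  have hS2 : 0 < S ^ 2 := by positivity
  refine le_of_mul_le_mul_right ?_ hS2
  linarith

/-- A measurable set having a proportion bounded below of every small square centred at a point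
of `S` contains almost all of `S`. -/
lemma volume_diff_eq_zero_of_density {S W : Set (ℝ × ℝ)} (hW : MeasurableSet W)
    (h : ∀ x ∈ S, ∃ c > 0, ∃ r₀ > 0, ∀ r, 0 < r → r < r₀ →
      c * volume.real (Metric.closedBall x r) ≤ volume.real (W ∩ Metric.closedBall x r)) :
    volume (S \ W) = 0 := by
  -- Almost every point of `Wᶜ` is a density point of `Wᶜ`, whereas a proportion `c` of `W` keeps
  -- that density at most `1 - c`. The constant `c` may depend on the point.
  have hae := IsUnifLocDoublingMeasure.ae_tendsto_measure_inter_div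
    (volume : Measure (ℝ × ℝ)) Wᶜ 0
  rw [ae_restrict_iff' hW.compl, ae_iff] at hae
  refine measure_mono_null ?_ hae
  rintro x ⟨hxS, hxW⟩ hx
  obtain ⟨c, hc, r₀, hr₀, hr⟩ := h x hxS
  have ht := hx hxW (l := 𝓝[>] (0 : ℝ)) (fun _ => x) (fun r => r) tendsto_id
    (eventually_mem_nhdsWithin.mono fun r hr => by
      simp)
  have ht' := (ENNReal.tendsto_toReal ENNReal.one_ne_top).comp ht
  have hle : (1 : ENNReal).toReal ≤ 1 - c := by
    refine le_of_tendsto ht' ?_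
    filter_upwards [Ioo_mem_nhdsGT hr₀] with r hr'
    have hfin : volume (Metric.closedBall x r) ≠ ⊤ := measure_closedBall_lt_top.ne
    have hpos : 0 < volume.real (Metric.closedBall x r) :=
      ENNReal.toReal_pos (Metric.measure_closedBall_pos _ _ hr'.1).ne' hfin
    have h1 := hr r hr'.1 hr'.2
    have h2 : volume.real (Metric.closedBall x r ∩ W) + volume.real (Metric.closedBall x r \ W) =
        volume.real (Metric.closedBall x r) := measureReal_inter_add_sdiff hW hfin
    rw [Function.comp_apply, ENNReal.toReal_div]
    change volume.real _ / volume.real _ ≤ _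
    rw [div_le_iff₀ hpos]
    have h3 : Wᶜ ∩ Metric.closedBall x r = Metric.closedBall x r \ W := by
      rw [inter_comm, sdiff_eq]
    rw [h3]
    rw [inter_comm] at h1
    linarith
  simp at hle
  linarith

/-! ### Strip estimates normalised by the height. -/

/-- A square of side `q` meets about `q G` strips, each of area about `q δ / H`. -/
lemma volume_real_stripSet_ge {A B H G R q δ s₁ s₂ : ℝ} {p : ℕ} (hp : 0 < p) (hG : 1 ≤ G)
    (hGH : G ^ p = H) (hR : 1 ≤ R) (hA : H ≤ R * A) (hA' : A ≤ H) (hB : 0 ≤ B) (hB' : B ≤ H)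
    (hq : 0 < q) (hs₁ : 0 ≤ s₁) (hs₂ : 0 ≤ s₂) (hs₁' : s₁ + q ≤ 1) (hs₂' : s₂ + q ≤ 1)
    (hδ : 0 ≤ δ) (hδ' : δ ≤ 1 / 2) (hqG : 4 * R * (p * 2 ^ (p - 1)) ≤ q * G) :
    q ^ 2 / (p * 2 ^ (p - 1)) * (δ * G / H) ≤
      volume.real (stripSet A B p δ (Icc s₁ (s₁ + q) ×ˢ Icc s₂ (s₂ + q))) := by
  set K : ℝ := p * 2 ^ (p - 1) with hK
  have hK1 : 1 ≤ K := by
    have h1 : (1 : ℝ) ≤ p := by exact_mod_cast hp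
    have h2 : (1 : ℝ) ≤ 2 ^ (p - 1) := one_le_pow₀ (by norm_num)
    exact one_le_mul_of_one_le_of_one_le h1 h2
  have hG0 : 0 < G := by linarith
  have hGH' : G ≤ H := by
    rw [← hGH]
    exact le_self_pow₀ hG hp.ne'
  have hH0 : 0 < H := hG0.trans_le hGH'
  have hR0 : 0 < R := by linarith
  have hA0 : 0 < A := by
    by_contra h
    have : R * A ≤ 0 := mul_nonpos_of_nonneg_of_nonpos hR0.le (not_lt.1 h)
    linarith
  have hAi : A⁻¹ ≤ R / H := by
    rw [inv_eq_one_div, div_le_div_iff₀ hA0 hH0]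
    linarith
  have hqA : 1 ≤ A * q := by
    have h1 : q * G ≤ q * (R * A) := mul_le_mul_of_nonneg_left (hGH'.trans hA) hq.le
    have h2 : R * 1 ≤ R * (A * q) := by nlinarith
    exact le_of_mul_le_mul_left h2 hR0
  have hden : p * (2 * G) ^ (p - 1) = K * (H / G) := by
    have : G ^ (p - 1) = H / G := by
      rw [eq_div_iff hG0.ne', ← pow_succ, Nat.sub_add_cancel hp, hGH]
    rw [mul_pow, this, hK]
    ring
  have hbd : A * (s₁ + q) + B * (s₂ + q) ≤ (2 * G) ^ p := by
    have h1 : A * (s₁ + q) ≤ A := mul_le_of_le_one_right hA0.le hs₁'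
    have h2 : B * (s₂ + q) ≤ B := mul_le_of_le_one_right hB hs₂'
    have h3 : (2 : ℝ) ≤ 2 ^ p := le_self_pow₀ (by norm_num) hp.ne'
    rw [mul_pow, hGH]
    nlinarith
  have h := le_volume_stripSet hp hA0 hB hs₁ hs₂ hq.le hδ hδ' (by linarith)
    (by positivity : (0 : ℝ) < 2 * G) hbd
  rw [hden] at h
  have hfin : volume (stripSet A B p δ (Icc s₁ (s₁ + q) ×ˢ Icc s₂ (s₂ + q))) ≠ ⊤ := by
    refine ne_top_of_le_ne_top ?_ (measure_mono fun x hx => hx.1)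
    exact (isCompact_Icc.prod isCompact_Icc).measure_lt_top.ne
  refine le_trans ?_ ((ENNReal.ofReal_le_iff_le_toReal hfin).1 h)
  have e : q * (A⁻¹ * (2 * δ * ((A * q - 2 * δ) / (K * (H / G)) - 1))) =
      2 * δ * q * (q * G / (K * H) - A⁻¹ * (2 * δ * (G / (K * H)) + 1)) := by
    field_simp
    ring
  rw [e]
  have h1 : A⁻¹ * (2 * δ * (G / (K * H)) + 1) ≤ R / H * 2 := by
    have h2 : G / (K * H) ≤ 1 := by
      rw [div_le_one (by positivity)]
      nlinarith
    have h3 : 0 ≤ G / (K * H) := by positivity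
    have h4 : 2 * δ * (G / (K * H)) + 1 ≤ 2 := by nlinarith
    exact mul_le_mul hAi h4 (by positivity) (by positivity)
  -- The assumption on `q G` makes the rounding loss at most half of the main term.
  have h2 : R / H * 2 ≤ q * G / (K * H) / 2 := by
    rw [div_div, div_mul_eq_mul_div, div_le_div_iff₀ (by positivity) (by positivity)]
    have : 4 * R * K * H ≤ q * G * H := mul_le_mul_of_nonneg_right hqG hH0.le
    linarith
  calc q ^ 2 / K * (δ * G / H) = 2 * δ * q * (q * G / (K * H) / 2) := by
        field_simp
    _ ≤ _ := mul_le_mul_of_nonneg_left (by linarith) (by positivity)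

/-- A crude bound without the gain `q ^ 2`, needed only for the diagonal terms of the second moment.
-/
lemma volume_real_stripSet_le {A B H R δ s₁ s₂ q : ℝ} {p G : ℕ} (hp : 0 < p) (hG : 1 ≤ G)
    (hGH : (G : ℝ) ^ p = H) (hR : 1 ≤ R) (hA : H ≤ R * A) (hA' : A ≤ H) (hB : 0 < B) (hB' : B ≤ H)
    (hs₁ : 0 ≤ s₁) (hs₂ : 0 ≤ s₂) (hs₁' : s₁ + q ≤ 1) (hs₂' : s₂ + q ≤ 1)
    (hδ : 0 ≤ δ) (hδ' : δ ≤ 1 / 2) :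
    volume.real (stripSet A B p δ (Icc s₁ (s₁ + q) ×ˢ Icc s₂ (s₂ + q))) ≤
      6 * R * (δ * G / H) := by
  have hGR : (1 : ℝ) ≤ G := by exact_mod_cast hG
  have hH1 : 1 ≤ H := by
    rw [← hGH]
    exact one_le_pow₀ hGR
  have hR0 : 0 < R := by linarith
  have hA0 : 0 < A := by
    by_contra h
    have : R * A ≤ 0 := mul_nonpos_of_nonneg_of_nonpos hR0.le (not_lt.1 h)
    linarith
  have hN : A + B + δ ≤ ((3 * G : ℕ) : ℝ) ^ p := by
    push_cast
    have h3 : (3 : ℝ) ≤ 3 ^ p := le_self_pow₀ (by norm_num) hp.ne'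
    rw [mul_pow, hGH]
    nlinarith
  have h := volume_strips_inter_square_le hA0 hB hN
  have hsub : stripSet A B p δ (Icc s₁ (s₁ + q) ×ˢ Icc s₂ (s₂ + q)) ⊆
      stripSet A B p δ (Icc (0 : ℝ) 1 ×ˢ Icc (0 : ℝ) 1) := fun x hx =>
    ⟨⟨⟨hs₁.trans hx.1.1.1, hx.1.1.2.trans hs₁'⟩, ⟨hs₂.trans hx.1.2.1, hx.1.2.2.trans hs₂'⟩⟩, hx.2⟩
  have hM : 0 < max A B := lt_max_of_lt_left hA0
  refine (ENNReal.toReal_le_of_le_ofReal (by positivity) ((measure_mono hsub).trans h)).trans ?_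
  have h1 : 2 * δ / max A B ≤ 2 * δ * (R / H) := by
    rw [div_eq_mul_inv]
    refine mul_le_mul_of_nonneg_left ?_ (by positivity)
    rw [inv_eq_one_div, div_le_div_iff₀ hM (by linarith)]
    have := mul_le_mul_of_nonneg_left (le_max_left A B) hR0.le
    linarith
  calc ((3 * G : ℕ) : ℝ) * (2 * δ / max A B) ≤ ((3 * G : ℕ) : ℝ) * (2 * δ * (R / H)) :=
        mul_le_mul_of_nonneg_left h1 (by positivity)
    _ = _ := by
        push_cast
        ring

/-- Distance `ε` from the axes keeps both forms above `(κ G) ^ p` and `(κ G') ^ p` with `κ = ε / R`,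
so the relevant gaps between `p`-th powers have their typical size up to `κ ^ (p - 1)`. The term
with `|D|⁻¹` accounts for slices on which the second form varies by less than one gap. -/
lemma volume_real_stripSet_inter_le {A B A' B' D H H' G G' R q δ δ' s₁ s₂ ε : ℝ} {p : ℕ}
    (hp : 0 < p) (hG : 1 ≤ G) (hG' : 1 ≤ G') (hGH : G ^ p = H) (hGH' : G' ^ p = H') (hR : 1 ≤ R)
    (hA : H ≤ R * A) (hAH : A ≤ H) (hB : H ≤ R * B) (hBH : B ≤ H)
    (hA' : H' ≤ R * A') (hB' : H' ≤ R * B')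
    (hD : D = A * B' - A' * B) (hD0 : D ≠ 0) (hq : 0 < q) (hq1 : q ≤ 1) (hε : 0 < ε)
    (hε1 : ε ≤ 1) (hs₁ : ε ≤ s₁) (hs₂ : ε ≤ s₂) (hδ : 0 ≤ δ) (hδ2 : δ ≤ 1 / 2) (hδ' : 0 ≤ δ')
    (hδ2' : δ' ≤ 1 / 2) (hqG : 1 ≤ q * G) (hεG : R ≤ ε * G) (hεG' : R ≤ ε * G') :
    volume.real (stripSet A B p δ (Icc s₁ (s₁ + q) ×ˢ Icc s₂ (s₂ + q)) ∩
        stripSet A' B' p δ' (Icc s₁ (s₁ + q) ×ˢ Icc s₂ (s₂ + q))) ≤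
      32 * R / ((ε / R) ^ (p - 1)) ^ 2 *
        (q ^ 2 * ((δ * G / H) * (δ' * G' / H')) + δ * δ' * G * |D|⁻¹) := by
  have hR0 : 0 < R := by linarith
  set κ := ε / R with hκ
  have hκ0 : 0 < κ := by positivity
  have hκ1 : κ ≤ 1 := (div_le_one hR0).2 (hε1.trans hR)
  set κ' := κ ^ (p - 1) with hκ'
  have hκ'0 : 0 < κ' := by positivity
  have hκ'1 : κ' ≤ 1 := pow_le_one₀ hκ0.le hκ1
  have hDpos : 0 < |D| := abs_pos.2 hD0
  have size : ∀ {G H : ℝ}, 1 ≤ G → G ^ p = H → 0 < G ∧ G ≤ H := by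
    intro G H h1 h2
    refine ⟨by linarith, ?_⟩
    rw [← h2]
    exact le_self_pow₀ h1 hp.ne'
  have posi : ∀ {H A : ℝ}, 0 < H → H ≤ R * A → 0 < A := by
    intro H A h1 h2
    by_contra h
    have : R * A ≤ 0 := mul_nonpos_of_nonneg_of_nonpos hR0.le (not_lt.1 h)
    linarith
  obtain ⟨hG0, hGle⟩ := size hG hGH
  obtain ⟨hG0', hGle'⟩ := size hG' hGH'
  have hH0 : 0 < H := hG0.trans_le hGle
  have hH0' : 0 < H' := hG0'.trans_le hGle'
  have hA0 := posi hH0 hA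
  have hB0 := posi hH0 hB
  have hA0' := posi hH0' hA'
  have hB0' := posi hH0' hB'
  have base : ∀ {A B G H δ : ℝ}, 0 < G → G ≤ H → G ^ p = H → H ≤ R * A → H ≤ R * B → 0 < A →
      0 < B → δ ≤ 1 / 2 → R ≤ ε * G → (κ * G) ^ p ≤ A * s₁ + B * s₂ - δ := by
    intro A B G H δ h0 h1 h2 h3 h4 h5 h6 h7 h8
    have e1 : κ ^ p ≤ κ := pow_le_of_le_one hκ0.le hκ1 hp.ne'
    have hHp : 0 < H := h0.trans_le h1
    have e2 : (κ * G) ^ p ≤ κ * H := by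
      rw [mul_pow, h2]
      exact mul_le_mul_of_nonneg_right e1 hHp.le
    have e3 : κ * H ≤ ε * A := by
      rw [hκ, div_mul_eq_mul_div, div_le_iff₀ hR0]
      have := mul_le_mul_of_nonneg_left h3 hε.le
      linarith
    have e4 : κ * H ≤ ε * B := by
      rw [hκ, div_mul_eq_mul_div, div_le_iff₀ hR0]
      have := mul_le_mul_of_nonneg_left h4 hε.le
      linarith
    have e5 : 1 ≤ κ * H := by
      rw [hκ, div_mul_eq_mul_div, le_div_iff₀ hR0]
      have := mul_le_mul_of_nonneg_left h1 hε.le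
      linarith
    have e6 := mul_le_mul_of_nonneg_left hs₁ h5.le
    have e7 := mul_le_mul_of_nonneg_left hs₂ h6.le
    linarith
  have gap : ∀ {G H : ℝ}, 0 < G → G ^ p = H → (κ * G) ^ (p - 1) = κ' * (H / G) := by
    intro G H h0 h1
    have : G ^ (p - 1) = H / G := by
      rw [eq_div_iff h0.ne', ← pow_succ, Nat.sub_add_cancel hp, h1]
    rw [mul_pow, this]
  have h := volume_stripSet_inter_le (q := q) (δ := δ) (δ' := δ') (s₁ := s₁) (s₂ := s₂)
    (s := κ * G) (s' := κ * G') hp hA0 hB0 hA0' hB0' hD hD0 hq.le hδ hδ'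
    (by positivity) (base hG0 hGle hGH hA hB hA0 hB0 hδ2 hεG) (by positivity) (gap hG0 hGH).ge
    (by positivity) (base hG0' hGle' hGH' hA' hB' hA0' hB0' hδ2' hεG') (by positivity)
    (gap hG0' hGH').ge
  have hf1 : 1 + ((A + B) * q + 2 * δ) / (κ' * (H / G)) ≤ 4 * (q * G) / κ' := by
    have e1 : (A + B) * q + 2 * δ ≤ 2 * H * q + 1 := by nlinarith
    have e2 : ((A + B) * q + 2 * δ) / (κ' * (H / G)) ≤ (2 * H * q + 1) / (κ' * (H / G)) := by
      gcongr
    have e3 : (2 * H * q + 1) / (κ' * (H / G)) = (2 * (q * G) + G / H) / κ' := by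
      field_simp
    have e4 : G / H ≤ 1 := (div_le_one hH0).2 hGle
    have e5 : 1 ≤ q * G / κ' := by
      rw [le_div_iff₀ hκ'0]
      linarith
    have e6 : (2 * (q * G) + G / H) / κ' ≤ (3 * (q * G)) / κ' := by
      gcongr
      linarith
    have e7 : 4 * (q * G) / κ' = q * G / κ' + (3 * (q * G)) / κ' := by ring
    linarith
  have hf2 : 1 + (|D| * q / A + 2 * δ') / (κ' * (H' / G')) ≤
      (2 + |D| * q * R * G' / (H * H')) / κ' := by
    have e1 : |D| * q / A ≤ |D| * q * (R / H) := by
      rw [div_eq_mul_inv]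
      refine mul_le_mul_of_nonneg_left ?_ (by positivity)
      rw [inv_eq_one_div, div_le_div_iff₀ hA0 hH0]
      linarith
    have e2 : (|D| * q / A + 2 * δ') / (κ' * (H' / G')) ≤
        (|D| * q * (R / H) + 1) / (κ' * (H' / G')) := by
      gcongr
      linarith
    have e3 : (|D| * q * (R / H) + 1) / (κ' * (H' / G')) =
        (|D| * q * R * G' / (H * H') + G' / H') / κ' := by
      field_simp
    have e4 : G' / H' ≤ 1 := (div_le_one hH0').2 hGle'
    have e5 : 1 ≤ 1 / κ' := by
      rw [le_div_iff₀ hκ'0]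
      linarith
    have e6 : (|D| * q * R * G' / (H * H') + G' / H') / κ' ≤
        (|D| * q * R * G' / (H * H') + 1) / κ' := by
      gcongr
    have e7 : (2 + |D| * q * R * G' / (H * H')) / κ' =
        1 / κ' + (|D| * q * R * G' / (H * H') + 1) / κ' := by ring
    linarith
  have hg1 : 0 ≤ 1 + ((A + B) * q + 2 * δ) / (κ' * (H / G)) := by positivity
  refine (ENNReal.toReal_le_of_le_ofReal (by positivity) h).trans ?_
  calc A⁻¹ * ((A / |D| * (2 * δ' * (1 + (|D| * q / A + 2 * δ') / (κ' * (H' / G'))))) *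
        (2 * δ * (1 + ((A + B) * q + 2 * δ) / (κ' * (H / G)))))
      ≤ A⁻¹ * ((A / |D| * (2 * δ' * ((2 + |D| * q * R * G' / (H * H')) / κ'))) *
        (2 * δ * (4 * (q * G) / κ'))) := by gcongr
    _ = 16 / κ' ^ 2 * (R * (q ^ 2 * ((δ * G / H) * (δ' * G' / H'))) +
        2 * (q * (δ * δ' * G * |D|⁻¹))) := by
        field_simp
        ring
    _ ≤ 16 / κ' ^ 2 * (2 * R * (q ^ 2 * ((δ * G / H) * (δ' * G' / H'))) +
        2 * (R * (δ * δ' * G * |D|⁻¹))) := by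
        have e1 : 0 ≤ q ^ 2 * ((δ * G / H) * (δ' * G' / H')) := by positivity
        have e2 : 0 ≤ δ * δ' * G * |D|⁻¹ := by positivity
        have e3 : q * (δ * δ' * G * |D|⁻¹) ≤ R * (δ * δ' * G * |D|⁻¹) :=
          mul_le_mul_of_nonneg_right (hq1.trans hR) e2
        have e4 := mul_nonneg hR0.le e1
        refine mul_le_mul_of_nonneg_left ?_ (by positivity)
        linarith
    _ = _ := by ring

/-! ### The limsup set over blocks has full measure. -/

lemma pairBlock_disjoint {n m p k k' : ℕ} (hm : 0 < m) (hp : 0 < p) {v : ℕ × ℕ}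
    (hv : v ∈ pairBlock n m p k) (hv' : v ∈ pairBlock n m p k') : k = k' := by
  have key : ∀ {i j : ℕ}, v ∈ pairBlock n m p i → v ∈ pairBlock n m p j → ¬ i < j := by
    intro i j hi hj hij
    rw [pairBlock, mem_coprimeBlock] at hi hj
    have h1 : 8 ^ (i * (m * p) + 1) ≤ 8 ^ (j * (m * p)) := by
      refine Nat.pow_le_pow_right (by norm_num) ?_
      have h2 : 0 < m * p := Nat.mul_pos hm hp
      have h3 := Nat.mul_le_mul_right (m * p) (Nat.succ_le_of_lt hij)
      rw [Nat.succ_mul] at h3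
      omega
    have h4 := hi.1.1.2
    have h5 := hj.2.1
    rw [pow_succ] at h1
    omega
  exact le_antisymm (not_lt.1 (key hv' hv)) (not_lt.1 (key hv hv'))

lemma pairBlock_bounds {n m p k : ℕ} {v : ℕ × ℕ} (hv : v ∈ pairBlock n m p k) :
    ((8 : ℝ) ^ (k * (n * m * p)) ≤ 8 ^ (n + m) * (v.1 : ℝ) ^ n ∧
      (v.1 : ℝ) ^ n ≤ 8 ^ (k * (n * m * p))) ∧
    ((8 : ℝ) ^ (k * (n * m * p)) ≤ 8 ^ (n + m) * (v.2 : ℝ) ^ m ∧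
      (v.2 : ℝ) ^ m ≤ 8 ^ (k * (n * m * p))) := by
  rw [pairBlock, mem_coprimeBlock] at hv
  have e1 : (8 ^ (k * (m * p))) ^ n = 8 ^ (k * (n * m * p)) := by
    rw [← pow_mul]
    ring_nf
  have e2 : (8 ^ (k * (n * p))) ^ m = 8 ^ (k * (n * m * p)) := by
    rw [← pow_mul]
    ring_nf
  have a1 : 8 ^ (k * (n * m * p)) ≤ 8 ^ (n + m) * v.1 ^ n := by
    calc _ ≤ (8 * v.1) ^ n := e1 ▸ Nat.pow_le_pow_left hv.2.1.le n
      _ = 8 ^ n * v.1 ^ n := mul_pow _ _ _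
      _ ≤ _ := Nat.mul_le_mul_right _ (Nat.pow_le_pow_right (by norm_num) (by omega))
  have a2 : 8 ^ (k * (n * m * p)) ≤ 8 ^ (n + m) * v.2 ^ m := by
    calc _ ≤ (8 * v.2) ^ m := e2 ▸ Nat.pow_le_pow_left hv.2.2.1.le m
      _ = 8 ^ m * v.2 ^ m := mul_pow _ _ _
      _ ≤ _ := Nat.mul_le_mul_right _ (Nat.pow_le_pow_right (by norm_num) (by omega))
  have b1 : v.1 ^ n ≤ 8 ^ (k * (n * m * p)) := e1 ▸ Nat.pow_le_pow_left hv.1.1.2 n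
  have b2 : v.2 ^ m ≤ 8 ^ (k * (n * m * p)) := e2 ▸ Nat.pow_le_pow_left hv.1.2.2 m
  exact ⟨⟨by exact_mod_cast a1, by exact_mod_cast b1⟩, ⟨by exact_mod_cast a2, by exact_mod_cast b2⟩⟩

/-- The points lying in strips of half-width `δ k` attached to the `k`-th block for infinitely
many `k`. -/
def blockLimsup (n m p : ℕ) (δ : ℕ → ℝ) : Set (ℝ × ℝ) :=
  {x | ∀ K, ∃ k ≥ K, ∃ v ∈ pairBlock n m p k,
    (v.1 : ℝ) ^ n * x.1 + (v.2 : ℝ) ^ m * x.2 ∈ powNhd p (δ k)}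

lemma measurableSet_blockLimsup (n m p : ℕ) (δ : ℕ → ℝ) :
    MeasurableSet (blockLimsup n m p δ) := by
  have h : blockLimsup n m p δ = ⋂ K : ℕ, ⋃ k ≥ K, ⋃ v ∈ pairBlock n m p k,
      (fun x : ℝ × ℝ => (v.1 : ℝ) ^ n * x.1 + (v.2 : ℝ) ^ m * x.2) ⁻¹' powNhd p (δ k) := by
    ext x
    simp [blockLimsup]
  rw [h]
  refine MeasurableSet.iInter fun K => MeasurableSet.iUnion fun k => MeasurableSet.iUnion fun _ =>
    Finset.measurableSet_biUnion _ fun v _ => ?_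
  have hc : Continuous fun x : ℝ × ℝ => (v.1 : ℝ) ^ n * x.1 + (v.2 : ℝ) ^ m * x.2 := by fun_prop
  exact ((isOpen_powNhd p (δ k)).preimage hc).measurableSet

lemma sum_measureReal_inter_pairBlock_le {n m p : ℕ} (hn : 0 < n) (hm : 0 < m) (hp : 0 < p)
    {δ : ℕ → ℝ} (hδ : ∀ k, 0 ≤ δ k) (hδ2 : ∀ k, δ k ≤ 1 / 2) {C₂ : ℝ} (hC₂ : 0 ≤ C₂)
    {k k' : ℕ} (hk : k ≤ k')
    (hdet : ∑ x ∈ pairBlock n m p k, ∑ y ∈ pairBlock n m p k', |(powDet n m x y : ℝ)|⁻¹ ≤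
      C₂ * (1 / 2) ^ (k' - k) *
        (blockDensity n m p k * blockDensity n m p k' * 8 ^ (k' * (n * m))))
    {ε q s₁ s₂ : ℝ} (hε : 0 < ε) (hε1 : ε ≤ 1) (hq : 0 < q) (hs₁ : ε ≤ s₁) (hs₂ : ε ≤ s₂)
    (hs₁' : s₁ + q ≤ 1) (hs₂' : s₂ + q ≤ 1)
    (hqG : 1 ≤ q * 8 ^ (k * (n * m))) (hεG : (8 : ℝ) ^ (n + m) ≤ ε * 8 ^ (k * (n * m)))
    {M : ℕ → ℝ} (hMdef : ∀ k, M k = δ k * 8 ^ (k * (n * m)) * blockDensity n m p k)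
    (hM1 : ∀ k, M k ≤ 1) {C₁ : ℝ}
    (hC₁ : C₁ = 32 * 8 ^ (n + m) / ((ε / 8 ^ (n + m)) ^ (p - 1)) ^ 2) :
    ∑ v ∈ pairBlock n m p k, ∑ w ∈ pairBlock n m p k',
      volume.real (stripSet ((v.1 : ℝ) ^ n) ((v.2 : ℝ) ^ m) p (δ k)
          (Icc s₁ (s₁ + q) ×ˢ Icc s₂ (s₂ + q)) ∩
        stripSet ((w.1 : ℝ) ^ n) ((w.2 : ℝ) ^ m) p (δ k')
          (Icc s₁ (s₁ + q) ×ˢ Icc s₂ (s₂ + q))) ≤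
      C₁ * q ^ 2 * (M k * M k') + (C₁ * C₂ + 6 * 8 ^ (n + m)) * (1 / 2) ^ (k' - k) * M k' := by
  set R : ℝ := 8 ^ (n + m) with hR
  have hR1 : 1 ≤ R := one_le_pow₀ (by norm_num)
  have hR0 : 0 < R := by linarith
  have hC₁0 : 0 ≤ C₁ := by
    rw [hC₁]
    positivity
  set G : ℕ → ℝ := fun j => 8 ^ (j * (n * m)) with hG
  set H : ℕ → ℝ := fun j => 8 ^ (j * (n * m * p)) with hH
  have hG1 : ∀ j, 1 ≤ G j := fun j => one_le_pow₀ (by norm_num)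
  have hG0 : ∀ j, 0 < G j := fun j => by linarith [hG1 j]
  have hH0 : ∀ j, 0 < H j := fun j => by simp only [hH]; positivity
  have hGH : ∀ j, G j ^ p = H j := fun j => by
    simp only [hG, hH]
    rw [← pow_mul]
    ring_nf
  have hGmono : G k ≤ G k' := pow_le_pow_right₀ (by norm_num) (Nat.mul_le_mul_right _ hk)
  set T : ℕ → ℝ := fun j => δ j * G j / H j with hT
  have hT0 : ∀ j, 0 ≤ T j := fun j =>
    div_nonneg (mul_nonneg (hδ j) (hG0 j).le) (hH0 j).le
  have hM0 : ∀ j, 0 ≤ M j := fun j => by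
    rw [hMdef]
    exact mul_nonneg (mul_nonneg (hδ j) (hG0 j).le) (blockDensity_pos n m p j).le
  have hcard : ∀ j, ((pairBlock n m p j).card : ℝ) * T j ≤ M j := by
    intro j
    have h1 : ((pairBlock n m p j).card : ℝ) ≤ 8 ^ (j * (m * p)) * 8 ^ (j * (n * p)) := by
      exact_mod_cast card_coprimeBlock_le _ _
    refine (mul_le_mul_of_nonneg_right h1 (hT0 j)).trans (le_of_eq ?_)
    rw [hMdef]
    simp only [hT, hG, hH, blockDensity]
    ring
  -- Equal pairs lie in the same block; there the determinant vanishes, its inverse is `0`, and the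
  -- full area of the strips is paid instead.
  have hterm : ∀ v ∈ pairBlock n m p k, ∀ w ∈ pairBlock n m p k',
      volume.real (stripSet ((v.1 : ℝ) ^ n) ((v.2 : ℝ) ^ m) p (δ k)
          (Icc s₁ (s₁ + q) ×ˢ Icc s₂ (s₂ + q)) ∩
        stripSet ((w.1 : ℝ) ^ n) ((w.2 : ℝ) ^ m) p (δ k')
          (Icc s₁ (s₁ + q) ×ˢ Icc s₂ (s₂ + q))) ≤
      C₁ * (q ^ 2 * (T k * T k') + δ k * δ k' * G k * |(powDet n m v w : ℝ)|⁻¹) +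
        if k = k' ∧ v = w then 6 * R * T k else 0 := by
    intro v hv w hw
    obtain ⟨⟨v1, v2⟩, ⟨v3, v4⟩⟩ := pairBlock_bounds hv
    obtain ⟨⟨w1, w2⟩, ⟨w3, w4⟩⟩ := pairBlock_bounds hw
    have hv' := mem_coprimeBlock.1 hv
    have hw' := mem_coprimeBlock.1 hw
    have hfirst : 0 ≤ C₁ * (q ^ 2 * (T k * T k') +
        δ k * δ k' * G k * |(powDet n m v w : ℝ)|⁻¹) := by
      have := hT0 k
      have := hT0 k'
      have := hδ k
      have := hδ k'
      have := (hG0 k).le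
      positivity
    by_cases hvw : v = w
    · subst hvw
      have hkk : k = k' := pairBlock_disjoint hm hp hv hw
      subst hkk
      rw [if_pos ⟨rfl, rfl⟩, inter_self]
      have h1 := volume_real_stripSet_le (A := (v.1 : ℝ) ^ n) (B := (v.2 : ℝ) ^ m) (q := q)
        (δ := δ k) (s₁ := s₁) (s₂ := s₂) (G := 8 ^ (k * (n * m))) hp (Nat.one_le_pow _ _ (by norm_num))
        (by have := hGH k; simp only [hG] at this; push_cast; exact this) hR1 v1 v2
        (pow_pos (by exact_mod_cast hv'.1.2.1) m) v4 (hε.le.trans hs₁) (hε.le.trans hs₂) hs₁' hs₂'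
        (hδ k) (hδ2 k)
      push_cast at h1
      linarith
    · rw [if_neg (fun h => hvw h.2), add_zero, hC₁]
      have hD0 : powDet n m v w ≠ 0 :=
        powDet_ne_zero hn hm hv'.2.2.2 hw'.2.2.2 hv'.1.1.1 hvw
      exact volume_real_stripSet_inter_le (D := (powDet n m v w : ℝ)) hp (hG1 k) (hG1 k') (hGH k)
        (hGH k') hR1 v1 v2 v3 v4 w1 w3 (by simp [powDet]) (by exact_mod_cast hD0) hq
        (by linarith) hε hε1 hs₁ hs₂ (hδ k) (hδ2 k) (hδ k') (hδ2 k') hqG hεG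
        (hεG.trans (mul_le_mul_of_nonneg_left hGmono hε.le))
  have hdiag : ∑ v ∈ pairBlock n m p k, ∑ w ∈ pairBlock n m p k',
      (if k = k' ∧ v = w then 6 * R * T k else 0) ≤ 6 * R * (1 / 2) ^ (k' - k) * M k' := by
    have hM0' := hM0 k'
    by_cases hkk : k = k'
    · subst hkk
      simp only [true_and, Finset.sum_ite_eq, Nat.sub_self, pow_zero, mul_one]
      rw [Finset.sum_congr rfl fun v hv => if_pos hv, Finset.sum_const, nsmul_eq_mul]
      have := mul_le_mul_of_nonneg_left (hcard k) (by positivity : 0 ≤ 6 * R)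
      linarith
    · simp only [hkk, false_and, if_false, Finset.sum_const_zero]
      positivity
  have hmain1 : ∑ v ∈ pairBlock n m p k, ∑ w ∈ pairBlock n m p k', q ^ 2 * (T k * T k') ≤
      q ^ 2 * (M k * M k') := by
    simp only [Finset.sum_const, nsmul_eq_mul]
    have h1 := mul_le_mul (hcard k) (hcard k')
      (mul_nonneg (Nat.cast_nonneg _) (hT0 k')) (hM0 k)
    have := mul_le_mul_of_nonneg_left h1 (sq_nonneg q)
    linarith
  have hmain2 : ∑ v ∈ pairBlock n m p k, ∑ w ∈ pairBlock n m p k',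
      δ k * δ k' * G k * |(powDet n m v w : ℝ)|⁻¹ ≤ C₂ * (1 / 2) ^ (k' - k) * M k' := by
    simp_rw [← Finset.mul_sum]
    have h0 : 0 ≤ δ k * δ k' * G k := mul_nonneg (mul_nonneg (hδ k) (hδ k')) (hG0 k).le
    refine (mul_le_mul_of_nonneg_left hdet h0).trans ?_
    have e : δ k * δ k' * G k * (C₂ * (1 / 2) ^ (k' - k) *
        (blockDensity n m p k * blockDensity n m p k' * 8 ^ (k' * (n * m)))) =
        C₂ * (1 / 2) ^ (k' - k) * (M k * M k') := by
      rw [hMdef, hMdef]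
      simp only [hG]
      ring
    rw [e]
    -- The truncation `M k ≤ 1` turns the product `M k * M k'` into the linear error that the limsup
    -- lemma tolerates.
    refine mul_le_mul_of_nonneg_left ?_ (by positivity)
    exact mul_le_of_le_one_left (hM0 k') (hM1 k)
  calc _ ≤ ∑ v ∈ pairBlock n m p k, ∑ w ∈ pairBlock n m p k',
        (C₁ * (q ^ 2 * (T k * T k') + δ k * δ k' * G k * |(powDet n m v w : ℝ)|⁻¹) +
          if k = k' ∧ v = w then 6 * R * T k else 0) :=
        Finset.sum_le_sum fun v hv => Finset.sum_le_sum fun w hw => hterm v hv w hw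
    _ = C₁ * (∑ v ∈ pairBlock n m p k, ∑ w ∈ pairBlock n m p k', q ^ 2 * (T k * T k') +
        ∑ v ∈ pairBlock n m p k, ∑ w ∈ pairBlock n m p k',
          δ k * δ k' * G k * |(powDet n m v w : ℝ)|⁻¹) +
        ∑ v ∈ pairBlock n m p k, ∑ w ∈ pairBlock n m p k',
          (if k = k' ∧ v = w then 6 * R * T k else 0) := by
        simp_rw [Finset.sum_add_distrib, mul_add, Finset.mul_sum, ← Finset.sum_add_distrib]
    _ ≤ C₁ * (q ^ 2 * (M k * M k') + C₂ * (1 / 2) ^ (k' - k) * M k') +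
        6 * R * (1 / 2) ^ (k' - k) * M k' := by gcongr
    _ = _ := by ring

/-- First moments carry `q ^ 2` and so does the main part of the second moment, so the ratio `l ^ 2
/ (4 u)` is a fixed multiple of `q ^ 2`. The error constant has no factor `q ^ 2`, but divergence
makes it irrelevant; thus `c` depends on `ε` and not on the square. -/
lemma le_volume_real_blockLimsup_inter {n m p : ℕ} (hn : 0 < n) (hm : 0 < m) (hp : 0 < p)
    (h : n ∣ m ∨ m ∣ n ∨ (p = 1 ∧ 2 ≤ Nat.gcd n m))
    {δ : ℕ → ℝ} (hδ : ∀ k, 0 ≤ δ k) (hδ2 : ∀ k, δ k ≤ 1 / 2)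
    (hM1 : ∀ k, δ k * 8 ^ (k * (n * m)) * blockDensity n m p k ≤ 1)
    (hsum : ¬ Summable fun k => δ k * 8 ^ (k * (n * m)) * blockDensity n m p k)
    {ε : ℝ} (hε : 0 < ε) (hε1 : ε ≤ 1) :
    ∃ c > 0, ∀ s₁ s₂ q : ℝ, 0 < q → ε ≤ s₁ → ε ≤ s₂ → s₁ + q ≤ 1 → s₂ + q ≤ 1 →
      c * q ^ 2 ≤ volume.real (blockLimsup n m p δ ∩ Icc s₁ (s₁ + q) ×ˢ Icc s₂ (s₂ + q)) := by
  obtain ⟨C₂, hC₂, hdet⟩ := exists_sum_inv_powDet_pairBlock_le (p := p) hn hm h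
  set R : ℝ := 8 ^ (n + m) with hR
  have hR1 : 1 ≤ R := one_le_pow₀ (by norm_num)
  have hR0 : 0 < R := by linarith
  set C₁ : ℝ := 32 * R / ((ε / R) ^ (p - 1)) ^ 2 with hC₁
  have hC₁0 : 0 < C₁ := by positivity
  set K₀ : ℝ := p * 2 ^ (p - 1) with hK₀
  have hpR : (0 : ℝ) < p := by exact_mod_cast hp
  have hK₀0 : 0 < K₀ := by positivity
  refine ⟨(1 / (18 * K₀)) ^ 2 / (4 * C₁), by positivity, ?_⟩
  intro s₁ s₂ q hq hs₁ hs₂ hs₁' hs₂'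
  set Q : Set (ℝ × ℝ) := Icc s₁ (s₁ + q) ×ˢ Icc s₂ (s₂ + q) with hQ
  have hQmeas : MeasurableSet Q := measurableSet_Icc.prod measurableSet_Icc
  have hQfin : volume Q < ⊤ := (isCompact_Icc.prod isCompact_Icc).measure_lt_top
  have : IsFiniteMeasure (volume.restrict Q) := ⟨by simpa using hQfin⟩
  set M : ℕ → ℝ := fun k => δ k * 8 ^ (k * (n * m)) * blockDensity n m p k with hM
  have hM0 : ∀ j, 0 ≤ M j := fun j =>
    mul_nonneg (mul_nonneg (hδ j) (by positivity)) (blockDensity_pos n m p j).le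
  set E : ℕ → ℕ × ℕ → Set (ℝ × ℝ) := fun k v =>
    stripSet ((v.1 : ℝ) ^ n) ((v.2 : ℝ) ^ m) p (δ k) Q with hE
  have hEmeas : ∀ k v, MeasurableSet (E k v) := fun k v => measurableSet_stripSet _ _ _ _ hQmeas
  have hrestr : ∀ S : Set (ℝ × ℝ), S ⊆ Q → (volume.restrict Q).real S = volume.real S := by
    intro S hS
    rw [Measure.real, Measure.restrict_eq_self _ hS, Measure.real]
  have hEQ : ∀ k v, E k v ⊆ Q := fun k v x hx => hx.1
  -- One threshold for all three largeness conditions on `G_k`; it may depend on `q`, since only the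
  -- tail of the blocks matters.
  obtain ⟨k₀, hk₀⟩ : ∃ k₀ : ℕ, 4 * R * K₀ / q + 1 / q + R / ε ≤ k₀ := exists_nat_ge _
  have hGbig : ∀ k ≥ k₀, 4 * R * K₀ ≤ q * 8 ^ (k * (n * m)) ∧ 1 ≤ q * 8 ^ (k * (n * m)) ∧
      R ≤ ε * 8 ^ (k * (n * m)) := by
    intro k hk
    have h1 : (k₀ : ℝ) ≤ 8 ^ (k * (n * m)) := by
      have h2 : k < 8 ^ k := Nat.lt_pow_self (by norm_num)
      have h3 : 8 ^ k ≤ 8 ^ (k * (n * m)) := Nat.pow_le_pow_right (by norm_num)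
        (Nat.le_mul_of_pos_right _ (Nat.mul_pos hn hm))
      have h4 : k₀ ≤ 8 ^ (k * (n * m)) := by omega
      exact_mod_cast h4
    have p1 : 0 ≤ 4 * R * K₀ / q := by positivity
    have p2 : 0 ≤ 1 / q := by positivity
    have p3 : 0 ≤ R / ε := by positivity
    have a1 : 4 * R * K₀ / q ≤ 8 ^ (k * (n * m)) := by linarith
    have a2 : 1 / q ≤ 8 ^ (k * (n * m)) := by linarith
    have a3 : R / ε ≤ 8 ^ (k * (n * m)) := by linarith
    rw [div_le_iff₀ (by assumption)] at a1 a2 a3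
    exact ⟨by linarith, by linarith, by linarith⟩
  have hfinal := le_measureReal_limsup_of_quasi_independent (volume.restrict Q) (pairBlock n m p) E
    hEmeas M hM0 hsum (l := q ^ 2 / (18 * K₀)) (u := C₁ * q ^ 2) (C := C₁ * C₂ + 6 * R)
    (by positivity) (by positivity) (by positivity) k₀ (by
      intro k hk
      have hlow : ∀ v ∈ pairBlock n m p k,
          q ^ 2 / K₀ * (δ k * 8 ^ (k * (n * m)) / 8 ^ (k * (n * m * p))) ≤
          (volume.restrict Q).real (E k v) := by
        intro v hv
        obtain ⟨⟨v1, v2⟩, ⟨v3, v4⟩⟩ := pairBlock_bounds hv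
        rw [hrestr _ (hEQ k v)]
        exact volume_real_stripSet_ge hp (one_le_pow₀ (by norm_num))
          (by rw [← pow_mul]; ring_nf) hR1 v1 v2 (by positivity) v4 hq (hε.le.trans hs₁)
          (hε.le.trans hs₂) hs₁' hs₂' (hδ k) (hδ2 k) (hGbig k hk).1
      refine le_trans ?_ (Finset.sum_le_sum hlow)
      rw [Finset.sum_const, nsmul_eq_mul]
      have hc := le_card_coprimeBlock (8 ^ (k * (m * p))) (8 ^ (k * (n * p)))
      have hδk := hδ k
      have e : q ^ 2 / (18 * K₀) * M k =
          (((8 ^ (k * (m * p)) : ℕ) : ℝ) * ((8 ^ (k * (n * p)) : ℕ) : ℝ)) / 18 *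
          (q ^ 2 / K₀ * (δ k * 8 ^ (k * (n * m)) / 8 ^ (k * (n * m * p)))) := by
        simp only [hM, blockDensity]
        push_cast
        field_simp
      rw [e]
      exact mul_le_mul_of_nonneg_right hc (by positivity))
    (by
      intro k hk k' hk'
      have h1 := sum_measureReal_inter_pairBlock_le hn hm hp hδ hδ2 hC₂ hk' (hdet k k' hk') hε hε1
        hq hs₁ hs₂ hs₁' hs₂' (hGbig k hk).2.1 (hGbig k hk).2.2 (M := M) (fun _ => rfl) hM1 hC₁
      refine le_trans (le_of_eq ?_) h1
      refine Finset.sum_congr rfl fun v _ => Finset.sum_congr rfl fun w _ => ?_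
      exact hrestr _ (inter_subset_left.trans (hEQ k v)))
  have hsub : {x | ∀ K, ∃ k ≥ K, ∃ v ∈ pairBlock n m p k, x ∈ E k v} ⊆
      blockLimsup n m p δ ∩ Q := by
    intro x hx
    refine ⟨fun K => ?_, ?_⟩
    · obtain ⟨k, hk, v, hv, hxv⟩ := hx K
      exact ⟨k, hk, v, hv, hxv.2⟩
    · obtain ⟨k, -, v, -, hxv⟩ := hx 0
      exact hxv.1
  rw [hrestr _ (hsub.trans inter_subset_right)] at hfinal
  have hfin : volume (blockLimsup n m p δ ∩ Q) ≠ ⊤ :=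
    ne_top_of_le_ne_top hQfin.ne (measure_mono inter_subset_right)
  refine le_trans (le_of_eq ?_) (hfinal.trans (measureReal_mono hsub hfin))
  field_simp

lemma volume_unitSquare_diff_blockLimsup {n m p : ℕ} (hn : 0 < n) (hm : 0 < m) (hp : 0 < p)
    (h : n ∣ m ∨ m ∣ n ∨ (p = 1 ∧ 2 ≤ Nat.gcd n m))
    {δ : ℕ → ℝ} (hδ : ∀ k, 0 ≤ δ k) (hδ2 : ∀ k, δ k ≤ 1 / 2)
    (hM1 : ∀ k, δ k * 8 ^ (k * (n * m)) * blockDensity n m p k ≤ 1)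
    (hsum : ¬ Summable fun k => δ k * 8 ^ (k * (n * m)) * blockDensity n m p k) :
    volume (Ioo (0 : ℝ) 1 ×ˢ Ioo (0 : ℝ) 1 \ blockLimsup n m p δ) = 0 := by
  refine volume_diff_eq_zero_of_density (measurableSet_blockLimsup n m p δ) fun x hx => ?_
  obtain ⟨⟨x1, x2⟩, ⟨x3, x4⟩⟩ := hx
  -- Half the distance to the axes, so that balls of radius below `ε` stay at distance `ε` from
  -- them. In the sup metric these balls are the squares treated above.
  set ε := min x.1 x.2 / 2 with hε
  have hmin : 0 < min x.1 x.2 := lt_min x1 x3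
  have hε0 : 0 < ε := by positivity
  have hm1 := min_le_left x.1 x.2
  have hm2 := min_le_right x.1 x.2
  obtain ⟨c, hc, hcq⟩ := le_volume_real_blockLimsup_inter hn hm hp h hδ hδ2 hM1 hsum hε0
    (by linarith)
  refine ⟨c, hc, min ε (min (1 - x.1) (1 - x.2)),
    lt_min hε0 (lt_min (by linarith) (by linarith)), fun r hr hr' => ?_⟩
  obtain ⟨r1, r23⟩ := lt_min_iff.1 hr'
  obtain ⟨r2, r3⟩ := lt_min_iff.1 r23
  have hball : Metric.closedBall x r =
      Icc (x.1 - r) (x.1 - r + 2 * r) ×ˢ Icc (x.2 - r) (x.2 - r + 2 * r) := by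
    rw [← Prod.mk.eta (p := x), ← closedBall_prod_same, Real.closedBall_eq_Icc,
      Real.closedBall_eq_Icc]
    congr 2 <;> ring_nf
  have hvol : volume.real (Metric.closedBall x r) = (2 * r) ^ 2 := by
    rw [hball, Measure.real, Measure.volume_eq_prod, Measure.prod_prod, Real.volume_Icc,
      Real.volume_Icc, ENNReal.toReal_mul, ENNReal.toReal_ofReal (by linarith),
      ENNReal.toReal_ofReal (by linarith)]
    ring
  rw [hvol, hball]
  exact hcq _ _ _ (by linarith) (by linarith) (by linarith) (by linarith) (by linarith)

/-! ### The convergence case. -/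

lemma coe_pairHeight (n m : ℕ) (a b : ℕ+) :
    ((pairHeight n m a b : ℕ+) : ℝ) = max ((a : ℝ) ^ n) ((b : ℝ) ^ m) := by
  have h : ((pairHeight n m a b : ℕ+) : ℕ) = max ((a : ℕ) ^ n) ((b : ℕ) ^ m) := by
    rw [pairHeight, ← PNat.pow_coe, ← PNat.pow_coe]
    exact (Subtype.mono_coe _).map_max
  rw [h]
  push_cast
  rfl

lemma volumeTerm_nonneg {n m p : ℕ} {ψ : ℕ+ → ℝ} (hψ : IsApproximatingFunction ψ) (ab : ℕ+ × ℕ+) :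
    0 ≤ volumeTerm n m p ψ ab := by
  unfold volumeTerm
  have := hψ.pos (pairHeight n m ab.1 ab.2)
  positivity

lemma volume_powStrips_le {n m p : ℕ} (hp : 0 < p) {ψ : ℕ+ → ℝ} (hψ : IsApproximatingFunction ψ) :
    ∃ C : ℝ, 0 ≤ C ∧ ∀ ab : ℕ+ × ℕ+,
      volume (stripSet ((ab.1 : ℝ) ^ n) ((ab.2 : ℝ) ^ m) p (ψ (pairHeight n m ab.1 ab.2))
        (Icc (0 : ℝ) 1 ×ˢ Icc (0 : ℝ) 1)) ≤ ENNReal.ofReal (C * volumeTerm n m p ψ ab) := by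
  -- On the unit square the form plus the error is at most `(2 + ψ 1) h ≤ (L h^(1/p)) ^ p`, so
  -- `O(h^(1/p))` values of `c` suffice.
  obtain ⟨L, hL⟩ := exists_nat_ge (2 + ψ 1)
  have hψ1 := hψ.pos 1
  refine ⟨2 * (L + 1), by positivity, fun ab => ?_⟩
  set h : ℝ := ((pairHeight n m ab.1 ab.2 : ℕ+) : ℝ) with hh
  have hh1 : 1 ≤ h := by
    rw [hh]
    exact_mod_cast one_le
  have hh0 : 0 < h := by linarith
  have hmax : h = max ((ab.1 : ℝ) ^ n) ((ab.2 : ℝ) ^ m) := coe_pairHeight n m ab.1 ab.2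
  have hψh : ψ (pairHeight n m ab.1 ab.2) ≤ ψ 1 := hψ.antitone one_le
  have hψ0 := hψ.pos (pairHeight n m ab.1 ab.2)
  set d := ψ (pairHeight n m ab.1 ab.2) with hd
  set r : ℝ := h ^ (1 / (p : ℝ)) with hr
  have hpR : (p : ℝ) ≠ 0 := by exact_mod_cast hp.ne'
  have hrp : r ^ p = h := by
    rw [hr, ← Real.rpow_natCast, ← Real.rpow_mul hh0.le, one_div_mul_cancel hpR, Real.rpow_one]
  have hr1 : 1 ≤ r := Real.one_le_rpow hh1 (by positivity)
  have hL1 : (1 : ℝ) ≤ L := by linarith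
  have hN : (ab.1 : ℝ) ^ n + (ab.2 : ℝ) ^ m + d ≤ ((⌈L * r⌉₊ : ℕ) : ℝ) ^ p := by
    have h1 : (L * r) ^ p ≤ ((⌈L * r⌉₊ : ℕ) : ℝ) ^ p :=
      pow_le_pow_left₀ (by positivity) (Nat.le_ceil _) p
    rw [mul_pow, hrp] at h1
    have h2 : (L : ℝ) ≤ L ^ p := le_self_pow₀ hL1 hp.ne'
    have h3 := le_max_left ((ab.1 : ℝ) ^ n) ((ab.2 : ℝ) ^ m)
    have h4 := le_max_right ((ab.1 : ℝ) ^ n) ((ab.2 : ℝ) ^ m)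
    rw [← hmax] at h3 h4
    have h5 : (L : ℝ) * h ≤ L ^ p * h := mul_le_mul_of_nonneg_right h2 hh0.le
    have h6 : (2 + ψ 1) * h ≤ L * h := mul_le_mul_of_nonneg_right hL hh0.le
    have h7 : ψ 1 * 1 ≤ ψ 1 * h := mul_le_mul_of_nonneg_left hh1 hψ1.le
    linarith
  have hpos1 : (0 : ℝ) < (ab.1 : ℝ) ^ n := pow_pos (by exact_mod_cast ab.1.pos) n
  have hpos2 : (0 : ℝ) < (ab.2 : ℝ) ^ m := pow_pos (by exact_mod_cast ab.2.pos) m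
  refine (volume_strips_inter_square_le hpos1 hpos2 hN).trans (ENNReal.ofReal_le_ofReal ?_)
  rw [← hmax]
  have hceil : ((⌈L * r⌉₊ : ℕ) : ℝ) ≤ (L + 1) * r := by
    have := Nat.ceil_lt_add_one (by positivity : 0 ≤ L * r)
    linarith
  have hterm : volumeTerm n m p ψ ab = d * r / h := by
    rw [volumeTerm, Real.rpow_sub hh0, Real.rpow_one, ← hr, ← hd, div_div_eq_mul_div]
  rw [hterm]
  calc ((⌈L * r⌉₊ : ℕ) : ℝ) * (2 * d / h) ≤ (L + 1) * r * (2 * d / h) := by gcongr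
    _ = _ := by ring

/-- If the volume sum converges, the approximable set is null. -/
lemma volume_approxSet_eq_zero {n m p : ℕ} (hp : 0 < p) {ψ : ℕ+ → ℝ}
    (hψ : IsApproximatingFunction ψ) (hs : Summable (volumeTerm n m p ψ)) :
    volume (approxSet n m p ψ) = 0 := by
  obtain ⟨C, hC, hvol⟩ := volume_powStrips_le (n := n) (m := m) hp hψ
  set S : ℕ+ × ℕ+ → Set (ℝ × ℝ) := fun ab =>
    stripSet ((ab.1 : ℝ) ^ n) ((ab.2 : ℝ) ^ m) p (ψ (pairHeight n m ab.1 ab.2))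
      (Icc (0 : ℝ) 1 ×ˢ Icc (0 : ℝ) 1)
  have hfin : ∑' ab, volume (S ab) ≠ ⊤ :=
    ne_top_of_le_ne_top (hs.mul_left C).tsum_ofReal_ne_top (ENNReal.tsum_le_tsum hvol)
  refine measure_mono_null (fun x hx => ?_) (measure_limsup_cofinite_eq_zero hfin)
  rw [mem_limsup_iff_frequently_mem, frequently_cofinite_iff_infinite]
  obtain ⟨hx01, hinf⟩ := hx
  intro hfinite
  apply hinf
  have hx' : x ∈ Icc (0 : ℝ) 1 ×ˢ Icc (0 : ℝ) 1 :=
    ⟨⟨hx01.1.1, hx01.1.2.le⟩, ⟨hx01.2.1, hx01.2.2.le⟩⟩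
  -- Each pair `(a, b)` admits finitely many `c`, so infinitely many triples need infinitely many
  -- pairs, as Borel–Cantelli requires.
  have hsub : {t : ℕ+ × ℕ+ × ℕ | |(t.1 : ℝ) ^ n * x.1 + (t.2.1 : ℝ) ^ m * x.2 - (t.2.2 : ℝ) ^ p| <
      ψ (pairHeight n m t.1 t.2.1)} ⊆
      ⋃ ab ∈ {ab | x ∈ S ab}, (fun c : ℕ => (ab.1, ab.2, c)) '' {c : ℕ | (c : ℝ) ^ p ≤
        (ab.1 : ℝ) ^ n * x.1 + (ab.2 : ℝ) ^ m * x.2 + ψ (pairHeight n m ab.1 ab.2)} := by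
    rintro ⟨a, b, c⟩ ht
    have ht' : |(a : ℝ) ^ n * x.1 + (b : ℝ) ^ m * x.2 - (c : ℝ) ^ p| <
      ψ (pairHeight n m a b) := ht
    refine mem_biUnion (x := (a, b)) (show x ∈ S (a, b) from ⟨hx', c, ht'⟩) ⟨c, ?_, rfl⟩
    have := (abs_lt.1 ht').1
    change (c : ℝ) ^ p ≤ (a : ℝ) ^ n * x.1 + (b : ℝ) ^ m * x.2 + ψ (pairHeight n m a b)
    linarith
  exact (hfinite.biUnion fun ab _ => (finite_pow_le hp _).image _).subset hsub

/-! ### Condensation of the volume sum and the divergence case. -/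

/-- The height `8 ^ (k n m p)` of the `k`-th block. -/
def blockHeight (n m p k : ℕ) : ℕ+ := 8 ^ (k * (n * m * p))

lemma coe_blockHeight (n m p k : ℕ) : (blockHeight n m p k : ℕ) = 8 ^ (k * (n * m * p)) := by
  rw [blockHeight, PNat.pow_coe]
  rfl

lemma volumeTerm_le_of_le_pairHeight {n m p : ℕ} (hp : 0 < p) {ψ : ℕ+ → ℝ}
    (hψ : IsApproximatingFunction ψ) {k : ℕ} {ab : ℕ+ × ℕ+}
    (hk : 8 ^ (k * (n * m * p)) ≤ (pairHeight n m ab.1 ab.2 : ℕ)) :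
    volumeTerm n m p ψ ab ≤
      ψ (blockHeight n m p k) * (8 ^ (k * (n * m)) / 8 ^ (k * (n * m * p))) := by
  have hle : blockHeight n m p k ≤ pairHeight n m ab.1 ab.2 := by
    rw [← PNat.coe_le_coe, coe_blockHeight]
    exact hk
  have hkR : (8 : ℝ) ^ (k * (n * m * p)) ≤ ((pairHeight n m ab.1 ab.2 : ℕ) : ℝ) := by
    exact_mod_cast hk
  have hpR : (0 : ℝ) < p := by exact_mod_cast hp
  have he : 0 ≤ 1 - 1 / (p : ℝ) := by
    rw [sub_nonneg, div_le_one hpR]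
    exact_mod_cast hp
  have e1 : ((8 : ℝ) ^ (k * (n * m * p))) ^ (1 - 1 / (p : ℝ)) =
      8 ^ (k * (n * m * p)) / 8 ^ (k * (n * m)) := by
    rw [Real.rpow_sub (by positivity), Real.rpow_one]
    congr 1
    have : (8 : ℝ) ^ (k * (n * m * p)) = (8 ^ (k * (n * m))) ^ p := by
      rw [← pow_mul]
      ring_nf
    rw [this, ← Real.rpow_natCast (8 ^ (k * (n * m))) p, ← Real.rpow_mul (by positivity),
      mul_one_div_cancel hpR.ne', Real.rpow_one]
  have h1 := Real.rpow_le_rpow (by positivity) hkR he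
  rw [e1] at h1
  have h2 : ψ (pairHeight n m ab.1 ab.2) ≤ ψ (blockHeight n m p k) := hψ.antitone hle
  have h3 := hψ.pos (pairHeight n m ab.1 ab.2)
  have h4 := hψ.pos (blockHeight n m p k)
  rw [volumeTerm, ← inv_div (8 ^ (k * (n * m * p)) : ℝ), ← div_eq_mul_inv]
  exact div_le_div₀ h4.le h2 (by positivity) h1

lemma card_le_of_pairHeight_lt {n m p k : ℕ} (s : Finset (ℕ+ × ℕ+))
    (hs : ∀ ab ∈ s, (pairHeight n m ab.1 ab.2 : ℕ) < 8 ^ ((k + 1) * (n * m * p))) :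
    s.card ≤ 8 ^ ((k + 1) * (m * p)) * 8 ^ ((k + 1) * (n * p)) := by
  have h : s.card ≤ (Finset.range (8 ^ ((k + 1) * (m * p))) ×ˢ
      Finset.range (8 ^ ((k + 1) * (n * p)))).card := by
    refine Finset.card_le_card_of_injOn (fun ab => ((ab.1 : ℕ), (ab.2 : ℕ))) ?_ ?_
    · intro ab hab
      have h1 := hs ab hab
      have ha : ab.1 ^ n ≤ pairHeight n m ab.1 ab.2 := le_max_left _ _
      have hb : ab.2 ^ m ≤ pairHeight n m ab.1 ab.2 := le_max_right _ _
      rw [← PNat.coe_le_coe, PNat.pow_coe] at ha hb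
      have e1 : 8 ^ ((k + 1) * (n * m * p)) = (8 ^ ((k + 1) * (m * p))) ^ n := by
        rw [← pow_mul]
        ring_nf
      have e2 : 8 ^ ((k + 1) * (n * m * p)) = (8 ^ ((k + 1) * (n * p))) ^ m := by
        rw [← pow_mul]
        ring_nf
      have ha' := ha.trans_lt h1
      have hb' := hb.trans_lt h1
      rw [e1] at ha'
      rw [e2] at hb'
      simp only [Finset.coe_product, Finset.coe_range, mem_prod, mem_Iio]
      exact ⟨lt_of_pow_lt_pow_left₀ n (Nat.zero_le _) ha',
        lt_of_pow_lt_pow_left₀ m (Nat.zero_le _) hb'⟩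
    · intro x _ y _ hxy
      simp only [Prod.mk.injEq, PNat.coe_inj] at hxy
      exact Prod.ext hxy.1 hxy.2
  simpa using h

/-- Comparison of the volume sum with its condensed version. -/
lemma summable_volumeTerm_of_summable {n m p : ℕ} (hn : 0 < n) (hm : 0 < m) (hp : 0 < p)
    {ψ : ℕ+ → ℝ} (hψ : IsApproximatingFunction ψ)
    (hs : Summable fun k => ψ (blockHeight n m p k) * 8 ^ (k * (n * m)) * blockDensity n m p k) :
    Summable (volumeTerm n m p ψ) := by
  classical
  set u : ℕ → ℝ := fun k => ψ (blockHeight n m p k) * 8 ^ (k * (n * m)) * blockDensity n m p k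
  have hu0 : ∀ k, 0 ≤ u k := fun k =>
    mul_nonneg (mul_nonneg (hψ.pos _).le (by positivity)) (blockDensity_pos n m p k).le
  set C : ℝ := 8 ^ (m * p) * 8 ^ (n * p) with hC
  have hC0 : 0 ≤ C := by positivity
  refine summable_of_sum_le (c := C * ∑' k, u k) (volumeTerm_nonneg hψ) fun s => ?_
  -- Cauchy condensation by level: heights in `[H_k, H_{k+1})` allow at most `N_{k+1} = C N_k`
  -- pairs.
  set lev : ℕ+ × ℕ+ → ℕ := fun ab =>
    Nat.log (8 ^ (n * m * p)) (pairHeight n m ab.1 ab.2 : ℕ) with hlev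
  have hbase : 1 < 8 ^ (n * m * p) := Nat.one_lt_pow (by positivity) (by norm_num)
  rw [← Finset.sum_fiberwise_of_maps_to (t := s.image lev) (g := lev)
    (fun x hx => Finset.mem_image_of_mem _ hx)]
  calc _ ≤ ∑ k ∈ s.image lev, C * u k := by
        refine Finset.sum_le_sum fun k _ => ?_
        have hfib : ∀ ab ∈ s.filter (lev · = k),
            8 ^ (k * (n * m * p)) ≤ (pairHeight n m ab.1 ab.2 : ℕ) ∧
            (pairHeight n m ab.1 ab.2 : ℕ) < 8 ^ ((k + 1) * (n * m * p)) := by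
          intro ab hab
          have h1 := (Finset.mem_filter.1 hab).2
          have h2 := Nat.pow_log_le_self (8 ^ (n * m * p)) (pairHeight n m ab.1 ab.2).ne_zero
          have h3 := Nat.lt_pow_succ_log_self hbase (pairHeight n m ab.1 ab.2 : ℕ)
          simp only [hlev] at h1
          rw [h1, ← pow_mul, mul_comm (n * m * p)] at h2 h3
          exact ⟨h2, h3⟩
        have hcard := card_le_of_pairHeight_lt _ fun ab hab => (hfib ab hab).2
        have hcardR : ((s.filter (lev · = k)).card : ℝ) ≤
            8 ^ ((k + 1) * (m * p)) * 8 ^ ((k + 1) * (n * p)) := by exact_mod_cast hcard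
        have hψ0 := hψ.pos (blockHeight n m p k)
        calc ∑ ab ∈ s.filter (lev · = k), volumeTerm n m p ψ ab
            ≤ ∑ ab ∈ s.filter (lev · = k),
              ψ (blockHeight n m p k) * (8 ^ (k * (n * m)) / 8 ^ (k * (n * m * p))) :=
              Finset.sum_le_sum fun ab hab => volumeTerm_le_of_le_pairHeight hp hψ (hfib ab hab).1
          _ = ((s.filter (lev · = k)).card : ℝ) *
              (ψ (blockHeight n m p k) * (8 ^ (k * (n * m)) / 8 ^ (k * (n * m * p)))) := by
              rw [Finset.sum_const, nsmul_eq_mul]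
          _ ≤ (8 ^ ((k + 1) * (m * p)) * 8 ^ ((k + 1) * (n * p))) *
              (ψ (blockHeight n m p k) * (8 ^ (k * (n * m)) / 8 ^ (k * (n * m * p)))) := by
              gcongr
          _ = C * u k := by
              simp only [hC, u, blockDensity]
              rw [add_mul, add_mul, one_mul, one_mul, pow_add, pow_add]
              ring
    _ ≤ C * ∑' k, u k := by
        rw [← Finset.mul_sum]
        exact mul_le_mul_of_nonneg_left (hs.sum_le_tsum _ fun k _ => hu0 k) hC0

/-- This says `1/n + 1/m + 1/p < 1`. A common factor `≥ 2` without divisibility forces `n, m ≥ 4`.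
-/
lemma mul_add_mul_add_lt_of_not_dvd {n m p : ℕ} (hn : 0 < n) (hm : 0 < m) (hp : 2 ≤ p)
    (hnm : 2 ≤ Nat.gcd n m) (h1 : ¬ n ∣ m) (h2 : ¬ m ∣ n) :
    m * p + n * p + n * m < n * m * p := by
  have four_le : ∀ {a b : ℕ}, 0 < a → ¬ a ∣ b → 2 ≤ Nat.gcd a b → 4 ≤ a := by
    intro a b ha hab hg
    obtain ⟨c, hc⟩ := Nat.gcd_dvd_left a b
    have hc2 : 2 ≤ c := by
      by_contra hlt
      have hc01 : c = 0 ∨ c = 1 := by omega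
      rcases hc01 with h | h
      · rw [h, mul_zero] at hc
        omega
      · rw [h, mul_one] at hc
        exact hab (hc ▸ Nat.gcd_dvd_right a b)
    calc 4 = 2 * 2 := rfl
      _ ≤ Nat.gcd a b * c := Nat.mul_le_mul hg hc2
      _ = a := hc.symm
  have hn4 := four_le hn h1 hnm
  have hm4 := four_le hm h2 (by rwa [Nat.gcd_comm])
  have hne : n ≠ m := fun h => h1 (h ▸ dvd_rfl)
  obtain ⟨i, rfl⟩ := Nat.exists_eq_add_of_le hn4
  obtain ⟨j, rfl⟩ := Nat.exists_eq_add_of_le hm4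
  obtain ⟨e, rfl⟩ := Nat.exists_eq_add_of_le hp
  -- Excludes `n = m = 4`, where `p = 2` would give equality.
  have hij : 1 ≤ i + j := by omega
  nlinarith [Nat.zero_le (i * j), Nat.zero_le (i * e), Nat.zero_le (j * e),
    Nat.zero_le (i * j * e)]

lemma summable_condensed_of_lt {n m p : ℕ} {ψ : ℕ+ → ℝ} (hψ : IsApproximatingFunction ψ)
    (h : m * p + n * p + n * m < n * m * p) :
    Summable fun k => ψ (blockHeight n m p k) * 8 ^ (k * (n * m)) * blockDensity n m p k := by
  refine Summable.of_nonneg_of_le (fun k => mul_nonneg (mul_nonneg (hψ.pos _).le (by positivity))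
    (blockDensity_pos n m p k).le) (fun k => ?_)
    ((summable_geometric_of_lt_one (r := (1 / 8 : ℝ)) (by norm_num) (by norm_num)).mul_left (ψ 1))
  have h1 : ψ (blockHeight n m p k) ≤ ψ 1 := hψ.antitone one_le
  have h2 : (8 : ℝ) ^ (k * (n * m)) * blockDensity n m p k ≤ (1 / 8) ^ k := by
    rw [blockDensity, ← mul_div_assoc, div_le_iff₀ (by positivity), one_div, inv_pow,
      ← pow_add, ← pow_add, le_inv_mul_iff₀ (by positivity), ← pow_add]
    refine pow_le_pow_right₀ (by norm_num) ?_
    have := Nat.mul_le_mul_left k (Nat.succ_le_of_lt h)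
    linarith
  have h3 : 0 ≤ (8 : ℝ) ^ (k * (n * m)) * blockDensity n m p k :=
    mul_nonneg (by positivity) (blockDensity_pos n m p k).le
  rw [mul_assoc]
  exact mul_le_mul h1 h2 h3 (hψ.pos 1).le

lemma blockLimsup_inter_subset_approxSet {n m p : ℕ} (hm : 0 < m) (hp : 0 < p)
    {ψ : ℕ+ → ℝ} (hψ : IsApproximatingFunction ψ) {δ : ℕ → ℝ}
    (hδ : ∀ k, δ k ≤ ψ (blockHeight n m p k)) :
    blockLimsup n m p δ ∩ Ioo (0 : ℝ) 1 ×ˢ Ioo (0 : ℝ) 1 ⊆ approxSet n m p ψ := by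
  rintro x ⟨hx, hx01⟩
  refine ⟨⟨⟨hx01.1.1.le, hx01.1.2⟩, ⟨hx01.2.1.le, hx01.2.2⟩⟩, fun hfin => ?_⟩
  obtain ⟨N, hN⟩ := (hfin.image fun t => (t.1 : ℕ)).bddAbove
  -- Members of the `k`-th block have first entry above `8 ^ (k m p) / 8 ≥ 8 ^ (N + 1) > N`; one
  -- unit of `k` pays for the factor `8` at the lower edge of the block.
  obtain ⟨k, hk, v, hv, c, hc⟩ := hx (N + 2)
  have hv' := mem_coprimeBlock.1 hv
  obtain ⟨⟨-, hA⟩, ⟨-, hB⟩⟩ := pairBlock_bounds hv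
  set a : ℕ+ := ⟨v.1, hv'.1.1.1⟩
  set b : ℕ+ := ⟨v.2, hv'.1.2.1⟩
  have hheight : pairHeight n m a b ≤ blockHeight n m p k := by
    refine max_le ?_ ?_ <;> rw [← PNat.coe_le_coe, coe_blockHeight, PNat.pow_coe]
    · exact_mod_cast hA
    · exact_mod_cast hB
  have hmem : (a, b, c) ∈ {t : ℕ+ × ℕ+ × ℕ |
      |(t.1 : ℝ) ^ n * x.1 + (t.2.1 : ℝ) ^ m * x.2 - (t.2.2 : ℝ) ^ p| <
        ψ (pairHeight n m t.1 t.2.1)} :=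
    hc.trans_le ((hδ k).trans (hψ.antitone hheight))
  have hle : v.1 ≤ N := hN (mem_image_of_mem _ hmem)
  have h1 : 8 ^ k ≤ 8 ^ (k * (m * p)) :=
    Nat.pow_le_pow_right (by norm_num) (Nat.le_mul_of_pos_right _ (Nat.mul_pos hm hp))
  have h2 : 8 ^ (N + 1) * 8 ≤ 8 ^ k := by
    rw [← pow_succ]
    exact Nat.pow_le_pow_right (by norm_num) hk
  have h3 : N + 1 < 8 ^ (N + 1) := Nat.lt_pow_self (by norm_num)
  have h4 := hv'.2.1
  omega

/-- If the volume sum diverges, the approximable set has full measure. -/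
lemma volume_approxSet_eq_one {n m p : ℕ} (hn : 0 < n) (hm : 0 < m) (hp : 0 < p)
    (hnm : (n = 1 ∧ m = 1) ∨ 2 ≤ Nat.gcd n m) {ψ : ℕ+ → ℝ} (hψ : IsApproximatingFunction ψ)
    (hs : ¬ Summable (volumeTerm n m p ψ)) : volume (approxSet n m p ψ) = 1 := by
  have hs' := fun h => hs (summable_volumeTerm_of_summable hn hm hp hψ h)
  -- Outside these cases the condensed sum converges for every `ψ`, against the assumed divergence.
  have hcase : n ∣ m ∨ m ∣ n ∨ (p = 1 ∧ 2 ≤ Nat.gcd n m) := by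
    by_contra! hcon
    obtain ⟨h1, h2, h3⟩ := hcon
    have hg : 2 ≤ Nat.gcd n m := by
      rcases hnm with ⟨rfl, rfl⟩ | h
      · exact absurd dvd_rfl h1
      · exact h
    have hp2 : 2 ≤ p := by
      by_contra hlt
      have := h3 (by omega)
      omega
    exact hs' (summable_condensed_of_lt hψ (mul_add_mul_add_lt_of_not_dvd hn hm hp2 hg h1 h2))
  set w : ℕ → ℝ := fun k => 8 ^ (k * (n * m)) * blockDensity n m p k with hw
  have hw0 : ∀ k, 0 < w k := fun k => mul_pos (by positivity) (blockDensity_pos n m p k)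
  -- Capping at `1 / 2` keeps neighbourhoods of distinct powers disjoint; capping at `(w k)⁻¹` gives
  -- `M_k ≤ 1`.
  set δ : ℕ → ℝ := fun k => min (min (ψ (blockHeight n m p k)) (1 / 2)) (w k)⁻¹ with hδ
  have hδ0 : ∀ k, 0 ≤ δ k := fun k =>
    le_min (le_min (hψ.pos _).le (by norm_num)) (inv_pos.2 (hw0 k)).le
  have hδ2 : ∀ k, δ k ≤ 1 / 2 := fun k => (min_le_left _ _).trans (min_le_right _ _)
  have hδψ : ∀ k, δ k ≤ ψ (blockHeight n m p k) := fun k =>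
    (min_le_left _ _).trans (min_le_left _ _)
  have hM1 : ∀ k, δ k * 8 ^ (k * (n * m)) * blockDensity n m p k ≤ 1 := by
    intro k
    rw [mul_assoc]
    calc δ k * w k ≤ (w k)⁻¹ * w k :=
          mul_le_mul_of_nonneg_right (min_le_right _ _) (hw0 k).le
      _ = 1 := inv_mul_cancel₀ (hw0 k).ne'
  have hsum : ¬ Summable fun k => δ k * 8 ^ (k * (n * m)) * blockDensity n m p k := by
    intro hsum
    apply hs'
    -- If the truncated series converged, its terms would tend to `0`, so neither cap would be
    -- active eventually and the original series would converge too.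
    have hlt1 := hsum.tendsto_atTop_zero.eventually_lt_const (by norm_num : (0 : ℝ) < 1)
    have hHtend : Tendsto (blockHeight n m p) atTop atTop := by
      refine tendsto_atTop.2 fun N => eventually_atTop.2 ⟨N, fun k hk => ?_⟩
      rw [← PNat.coe_le_coe, coe_blockHeight]
      have h1 : k < 8 ^ k := Nat.lt_pow_self (by norm_num)
      have h2 : 8 ^ k ≤ 8 ^ (k * (n * m * p)) := Nat.pow_le_pow_right (by norm_num)
        (Nat.le_mul_of_pos_right _ (by positivity))
      omega
    have hlt2 := (hψ.tendsto_zero.comp hHtend).eventually_lt_const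
      (by norm_num : (0 : ℝ) < 1 / 2)
    refine (summable_congr_atTop ?_).1 hsum
    filter_upwards [hlt1, hlt2] with k h1 h2
    have h2' : ψ (blockHeight n m p k) < 1 / 2 := h2
    have hmin : δ k = min (ψ (blockHeight n m p k)) (w k)⁻¹ := by
      simp only [hδ]
      rw [min_eq_left h2'.le]
    have h3 : δ k ≠ (w k)⁻¹ := by
      intro h
      rw [mul_assoc] at h1
      have : δ k * w k = 1 := by rw [h, inv_mul_cancel₀ (hw0 k).ne']
      linarith
    rcases min_choice (ψ (blockHeight n m p k)) (w k)⁻¹ with h | h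
    · rw [hmin, h]
    · exact absurd (hmin.trans h) h3
  have hnull := volume_unitSquare_diff_blockLimsup hn hm hp hcase hδ0 hδ2 hM1 hsum
  have hsub := blockLimsup_inter_subset_approxSet hm hp hψ hδψ
  have hsq : volume (Ioo (0 : ℝ) 1 ×ˢ Ioo (0 : ℝ) 1) = 1 := by
    rw [Measure.volume_eq_prod, Measure.prod_prod]
    simp
  have hsq' : volume (Ico (0 : ℝ) 1 ×ˢ Ico (0 : ℝ) 1) = 1 := by
    rw [Measure.volume_eq_prod, Measure.prod_prod]
    simp
  apply le_antisymm
  · rw [← hsq']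
    exact measure_mono fun x hx => hx.1
  · rw [← hsq]
    calc volume (Ioo (0 : ℝ) 1 ×ˢ Ioo (0 : ℝ) 1)
        ≤ volume (Ioo (0 : ℝ) 1 ×ˢ Ioo (0 : ℝ) 1 ∩ blockLimsup n m p δ) +
          volume (Ioo (0 : ℝ) 1 ×ˢ Ioo (0 : ℝ) 1 \ blockLimsup n m p δ) :=
          measure_le_inter_add_sdiff _ _ _
      _ ≤ volume (approxSet n m p ψ) := by
          rw [hnull, add_zero, inter_comm]
          exact measure_mono hsub

theorem theorem1 (n m p : ℕ) (hn : 0 < n) (hm : 0 < m) (hp : 0 < p)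
    (hnm : (n = 1 ∧ m = 1) ∨ 2 ≤ Nat.gcd n m)
    (ψ : ℕ+ → ℝ) (hψ : IsApproximatingFunction ψ) :
    (Summable (volumeTerm n m p ψ) → MeasureTheory.volume (approxSet n m p ψ) = 0) ∧
    (¬ Summable (volumeTerm n m p ψ) → MeasureTheory.volume (approxSet n m p ψ) = 1) :=
  ⟨volume_approxSet_eq_zero hp hψ, volume_approxSet_eq_one hn hm hp hnm hψ⟩
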